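/- Let $G_1$ and $G_2$ be locally compact (Hausdorff) groups. For a locally compact group $G$, let $\widehat{G}$ denote the unitary dual of $G$, i.e. the set of unitary equivalence classes of (strongly continuous, topologically) irreducible unitary representations of $G$, equipped with the Fell topology, i.e. the topology corresponding to the hull-kernel topology on the spectrum of the full group $\mathrm{C}^*$-algebra $\mathrm{C}^*(G)$. For unitary representations $\pi_i$ of $G_i$ on Hilbert spaces $H_i$ ($i=1,2$), let $\pi_1\otimes\pi_2$ be the unitary representation of $G_1\times G_2$ on the Hilbert space tensor product $H_1\otimes_2 H_2$ given by $(g_1,g_2)\mapsto \pi_1(g_1)\otimes\pi_2(g_2)$. Then there is a well-defined map $$J:\widehat{G_1}\times\widehat{G_2}\to\widehat{G_1\times G_2},\qquad J([\pi_1],[\pi_2])=[\pi_1\otimes\pi_2],$$ and, when $\widehat{G_1}\times\widehat{G_2}$ carries the product of the Fell topologies and $\widehat{G_1\times G_2}$ carries its Fell topology, $J$ is continuous and relatively open: for every open $W\subseteq\widehat{G_1}\times\widehat{G_2}$, the image $J(W)$ is a relatively open subset of the range of $J$. -/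

import Mathlib

open MeasureTheory Topology
open scoped TensorProduct ENNReal CompactlySupported

universe w u v

noncomputable section

/-! ### Unitary representations -/

/-- A (strongly continuous) unitary representation of the topological group `G` on a complex
Hilbert space. -/
structure UnitaryRep (G : Type u) [Group G] [TopologicalSpace G] : Type (max u (w + 1)) where
  /-- the underlying Hilbert space -/
  H : Type w
  [instNormed : NormedAddCommGroup H]
  [instInner : InnerProductSpace ℂ H]
  [instComplete : CompleteSpace H]
  /-- the homomorphism into the unitary group of `H` -/
  op : G →* (H ≃ₗᵢ[ℂ] H)
  continuous_op : ∀ ξ : H, Continuous fun g : G => op g ξ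

attribute [instance] UnitaryRep.instNormed UnitaryRep.instInner UnitaryRep.instComplete

namespace UnitaryRep

section Basic

variable {G : Type u} [Group G] [TopologicalSpace G]

/-- Topological irreducibility: the space is nonzero, and its only closed invariant subspaces are
zero and the whole space. -/
def IsIrreducible (π : UnitaryRep.{w} G) : Prop :=
  Nontrivial π.H ∧
    ∀ K : Submodule ℂ π.H, IsClosed (K : Set π.H) → (∀ g : G, ∀ ξ ∈ K, π.op g ξ ∈ K) →
      K = ⊥ ∨ K = ⊤

/-- Unitary equivalence of unitary representations. -/
def Equivalent (π σ : UnitaryRep.{w} G) : Prop :=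
  ∃ U : π.H ≃ₗᵢ[ℂ] σ.H, ∀ (g : G) (ξ : π.H), U (π.op g ξ) = σ.op g (U ξ)

theorem Equivalent.refl (π : UnitaryRep.{w} G) : Equivalent π π :=
  ⟨LinearIsometryEquiv.refl ℂ π.H, fun _ _ => rfl⟩

theorem Equivalent.symm {π σ : UnitaryRep.{w} G} (h : Equivalent π σ) : Equivalent σ π := by
  obtain ⟨U, hU⟩ := h
  refine ⟨U.symm, fun g ξ => ?_⟩
  apply U.injective
  rw [hU]
  simp

theorem Equivalent.trans {π σ ρ : UnitaryRep.{w} G} (h : Equivalent π σ) (h' : Equivalent σ ρ) :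
    Equivalent π ρ := by
  obtain ⟨U, hU⟩ := h
  obtain ⟨V, hV⟩ := h'
  exact ⟨U.trans V, fun g ξ => by simp [hU, hV]⟩

end Basic

/-! ### The exterior tensor product of representations -/

section Tensor

/-- The extension of a unitary operator between inner product spaces to their completions. -/
def completionIsometryEquiv {E F : Type*} [NormedAddCommGroup E] [InnerProductSpace ℂ E]
    [NormedAddCommGroup F] [InnerProductSpace ℂ F] (e : E ≃ₗᵢ[ℂ] F) :
    UniformSpace.Completion E ≃ₗᵢ[ℂ] UniformSpace.Completion F where
  toFun := (e : E →L[ℂ] F).completion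
  map_add' := map_add _
  map_smul' := map_smul _
  invFun := (e.symm : F →L[ℂ] E).completion
  left_inv x := by
    induction x using UniformSpace.Completion.induction_on with
    | hp => exact isClosed_eq (by fun_prop) continuous_id
    | ih a => simp
  right_inv x := by
    induction x using UniformSpace.Completion.induction_on with
    | hp => exact isClosed_eq (by fun_prop) continuous_id
    | ih a => simp
  norm_map' x := by
    induction x using UniformSpace.Completion.induction_on with
    | hp =>
      exact isClosed_eq ((e : E →L[ℂ] F).completion.continuous.norm) continuous_norm
    | ih a =>
      change ‖(e : E →L[ℂ] F).completion (a : UniformSpace.Completion E)‖ = _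
      simp

@[simp] theorem completionIsometryEquiv_coe {E F : Type*} [NormedAddCommGroup E]
    [InnerProductSpace ℂ E] [NormedAddCommGroup F] [InnerProductSpace ℂ F] (e : E ≃ₗᵢ[ℂ] F)
    (x : E) :
    completionIsometryEquiv e (x : UniformSpace.Completion E)
      = ((e x : F) : UniformSpace.Completion F) := by
  change (e : E →L[ℂ] F).completion (x : UniformSpace.Completion E) = _
  simp

variable {G₁ : Type u} [Group G₁] [TopologicalSpace G₁]
variable {G₂ : Type v} [Group G₂] [TopologicalSpace G₂]

/-- The operator `π₁(g₁) ⊗ π₂(g₂)` on the Hilbert space tensor product of the two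
representation spaces. -/
def tensorOp (π₁ : UnitaryRep.{w} G₁) (π₂ : UnitaryRep.{w} G₂) (p : G₁ × G₂) :
    UniformSpace.Completion (π₁.H ⊗[ℂ] π₂.H) ≃ₗᵢ[ℂ] UniformSpace.Completion (π₁.H ⊗[ℂ] π₂.H) :=
  completionIsometryEquiv (TensorProduct.congrIsometry (π₁.op p.1) (π₂.op p.2))

theorem tensorOp_coe_tmul (π₁ : UnitaryRep.{w} G₁) (π₂ : UnitaryRep.{w} G₂) (p : G₁ × G₂)
    (ξ : π₁.H) (η : π₂.H) :
    tensorOp π₁ π₂ p ((ξ ⊗ₜ[ℂ] η : π₁.H ⊗[ℂ] π₂.H) : UniformSpace.Completion (π₁.H ⊗[ℂ] π₂.H))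
      = ((π₁.op p.1 ξ ⊗ₜ[ℂ] π₂.op p.2 η : π₁.H ⊗[ℂ] π₂.H) :
          UniformSpace.Completion (π₁.H ⊗[ℂ] π₂.H)) := by
  simp [tensorOp]

theorem tensorOp_ext (π₁ : UnitaryRep.{w} G₁) (π₂ : UnitaryRep.{w} G₂)
    {S T : UniformSpace.Completion (π₁.H ⊗[ℂ] π₂.H) ≃ₗᵢ[ℂ]
      UniformSpace.Completion (π₁.H ⊗[ℂ] π₂.H)}
    (h : ∀ (ξ : π₁.H) (η : π₂.H),
      S ((ξ ⊗ₜ[ℂ] η : π₁.H ⊗[ℂ] π₂.H) : UniformSpace.Completion (π₁.H ⊗[ℂ] π₂.H))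
        = T ((ξ ⊗ₜ[ℂ] η : π₁.H ⊗[ℂ] π₂.H) : UniformSpace.Completion (π₁.H ⊗[ℂ] π₂.H))) :
    S = T := by
  ext x
  induction x using UniformSpace.Completion.induction_on with
  | hp => exact isClosed_eq S.continuous T.continuous
  | ih a =>
    induction a using TensorProduct.induction_on with
    | zero => rw [UniformSpace.Completion.coe_zero, map_zero, map_zero]
    | tmul ξ η => exact h ξ η
    | add a b ha hb => rw [UniformSpace.Completion.coe_add, map_add, map_add, ha, hb]

theorem continuous_tensorOp (π₁ : UnitaryRep.{w} G₁) (π₂ : UnitaryRep.{w} G₂)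
    (x : UniformSpace.Completion (π₁.H ⊗[ℂ] π₂.H)) :
    Continuous fun p : G₁ × G₂ => tensorOp π₁ π₂ p x := by
  have key : ∀ a : π₁.H ⊗[ℂ] π₂.H, Continuous fun p : G₁ × G₂ =>
      tensorOp π₁ π₂ p (a : UniformSpace.Completion (π₁.H ⊗[ℂ] π₂.H)) := by
    intro a
    induction a using TensorProduct.induction_on with
    | zero => simp only [UniformSpace.Completion.coe_zero, map_zero]; exact continuous_const
    | tmul ξ η =>
      simp only [tensorOp_coe_tmul]
      exact (UniformSpace.Completion.continuous_coe _).comp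
        ((TensorProduct.continuous_tmul (𝕜 := ℂ) (E := π₁.H) (F := π₂.H)).comp
          (((π₁.continuous_op ξ).comp continuous_fst).prodMk
            ((π₂.continuous_op η).comp continuous_snd)))
    | add a b ha hb =>
      simp only [UniformSpace.Completion.coe_add, map_add]
      exact ha.add hb
  refine continuous_of_uniform_approx_of_continuous fun u hu => ?_
  obtain ⟨ε, hε, hεu⟩ := Metric.mem_uniformity_dist.1 hu
  obtain ⟨a, ha⟩ := UniformSpace.Completion.denseRange_coe.exists_dist_lt x hε
  exact ⟨_, key a, fun p => hεu (by rwa [LinearIsometryEquiv.dist_map])⟩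

/-- The (exterior) tensor product `π₁ ⊗ π₂`, a unitary representation of `G₁ × G₂` on the Hilbert
space tensor product. -/
def tensor (π₁ : UnitaryRep.{w} G₁) (π₂ : UnitaryRep.{w} G₂) : UnitaryRep.{w} (G₁ × G₂) where
  H := UniformSpace.Completion (π₁.H ⊗[ℂ] π₂.H)
  op :=
    { toFun := tensorOp π₁ π₂
      map_one' := tensorOp_ext π₁ π₂ fun ξ η => by simp [tensorOp_coe_tmul]
      map_mul' := fun p q => tensorOp_ext π₁ π₂ fun ξ η => by simp [tensorOp_coe_tmul] }
  continuous_op := continuous_tensorOp π₁ π₂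

end Tensor

/-! ### The integrated form -/

section Integrated

variable {G : Type u} [Group G] [TopologicalSpace G] [IsTopologicalGroup G]
  [LocallyCompactSpace G]

variable (G) in
/-- Left Haar measure on the Borel sets of `G`. -/
def leftHaar : @Measure G (borel G) :=
  letI : MeasurableSpace G := borel G
  haveI : BorelSpace G := ⟨rfl⟩
  Measure.haar

theorem integrable_smul_op (π : UnitaryRep.{w} G) (f : C_c(G, ℂ)) (ξ : π.H) :
    Integrable (fun g => f g • π.op g ξ) (leftHaar G) := by
  let : MeasurableSpace G := borel G
  have : BorelSpace G := ⟨rfl⟩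
  change Integrable (fun g => f g • π.op g ξ) (Measure.haar : Measure G)
  exact Continuous.integrable_of_hasCompactSupport
    (f.continuous.smul (π.continuous_op ξ)) f.hasCompactSupport.smul_right

theorem integrable_norm (f : C_c(G, ℂ)) : Integrable (fun g => ‖f g‖) (leftHaar G) := by
  let : MeasurableSpace G := borel G
  have : BorelSpace G := ⟨rfl⟩
  change Integrable (fun g => ‖f g‖) (Measure.haar : Measure G)
  exact Continuous.integrable_of_hasCompactSupport f.continuous.norm f.hasCompactSupport.norm

/-- The integrated form `π(f) = ∫ f(g) π(g) dg` for a continuous compactly supported `f`. -/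
def integrated (π : UnitaryRep.{w} G) (f : C_c(G, ℂ)) : π.H →L[ℂ] π.H :=
  LinearMap.mkContinuous
    { toFun := fun ξ => ∫ g, f g • π.op g ξ ∂(leftHaar G)
      map_add' := fun ξ η => by
        rw [← integral_add (integrable_smul_op π f ξ) (integrable_smul_op π f η)]
        simp
      map_smul' := fun c ξ => by
        rw [RingHom.id_apply, ← integral_smul]
        simp [smul_comm c] }
    (∫ g, ‖f g‖ ∂(leftHaar G))
    (fun ξ => by
      refine (norm_integral_le_integral_norm _).trans (le_of_eq ?_)
      rw [← integral_mul_const]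
      simp [norm_smul])

theorem integrated_apply (π : UnitaryRep.{w} G) (f : C_c(G, ℂ)) (ξ : π.H) :
    π.integrated f ξ = ∫ g, f g • π.op g ξ ∂(leftHaar G) := rfl

theorem norm_integrated_le (π : UnitaryRep.{w} G) (f : C_c(G, ℂ)) :
    ‖π.integrated f‖ ≤ ∫ g, ‖f g‖ ∂(leftHaar G) :=
  LinearMap.mkContinuous_norm_le _ (integral_nonneg fun _ => norm_nonneg _) _

end Integrated

end UnitaryRep

/-! ### The full group C⋆-algebra -/

section GroupCStar

variable (G : Type u) [Group G] [TopologicalSpace G] [IsTopologicalGroup G]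
  [LocallyCompactSpace G]

/-- The C⋆-algebra of all uniformly bounded families of operators, indexed by all unitary
representations of `G` (on Hilbert spaces in the universe `w`). -/
abbrev OperatorFamily : Type (max u (w + 1)) :=
  lp (fun π : UnitaryRep.{w} G => π.H →L[ℂ] π.H) ∞

variable {G} in
/-- The universal representation `f ↦ (π(f))_π` of the continuous compactly supported functions. -/
def universalRep (f : C_c(G, ℂ)) : OperatorFamily.{w} G :=
  ⟨fun π => π.integrated f, memℓp_infty ⟨∫ g, ‖f g‖ ∂(UnitaryRep.leftHaar G), by
    rintro _ ⟨π, rfl⟩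
    exact π.norm_integrated_le f⟩⟩

/-- The full group C⋆-algebra `C⋆(G)`, that is, the completion of the convolution algebra of
continuous compactly supported functions for the norm `‖f‖ = sup_π ‖π(f)‖`. It is realized as the
closed ⋆-subalgebra generated by the operators `(π(f))_π` in the direct sum of all unitary
representations. The universe `w` has to be at least that of `G`, so that every cyclic (in
particular every irreducible) representation occurs up to equivalence. -/
def groupCStar : NonUnitalStarSubalgebra ℂ (OperatorFamily.{w} G) :=
  (NonUnitalStarAlgebra.adjoin ℂ (Set.range (universalRep.{w} (G := G)))).topologicalClosure

variable {G}

/-- The extension to `C⋆(G)` of the integrated form of the unitary representation `π`. -/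
def UnitaryRep.onCStar (π : UnitaryRep.{w} G) (x : groupCStar.{w} G) : π.H →L[ℂ] π.H :=
  (x : OperatorFamily.{w} G) π

theorem UnitaryRep.integrated_intertwine {π σ : UnitaryRep.{w} G} (U : π.H ≃ₗᵢ[ℂ] σ.H)
    (hU : ∀ (g : G) (ξ : π.H), U (π.op g ξ) = σ.op g (U ξ)) (f : C_c(G, ℂ)) (ξ : π.H) :
    U (π.integrated f ξ) = σ.integrated f (U ξ) := by
  rw [UnitaryRep.integrated_apply, UnitaryRep.integrated_apply]
  let : MeasurableSpace G := borel G
  have key := (U.toContinuousLinearEquiv : π.H →L[ℂ] σ.H).integral_comp_comm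
    (UnitaryRep.integrable_smul_op π f ξ)
  simpa [hU] using key.symm

/-- Elements of `C⋆(G)` act on equivalent representations by equivalent operators. -/
theorem UnitaryRep.onCStar_intertwine {π σ : UnitaryRep.{w} G} (U : π.H ≃ₗᵢ[ℂ] σ.H)
    (hU : ∀ (g : G) (ξ : π.H), U (π.op g ξ) = σ.op g (U ξ)) (x : groupCStar.{w} G) (ξ : π.H) :
    U (π.onCStar x ξ) = σ.onCStar x (U ξ) := by
  have hev : ∀ ρ : UnitaryRep.{w} G, Continuous fun y : OperatorFamily.{w} G => y ρ :=
    fun ρ => LipschitzWith.continuous (K := 1) (LipschitzWith.of_dist_le_mul fun y z => by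
      have := lp.norm_apply_le_norm ENNReal.top_ne_zero (y - z) ρ
      simpa [dist_eq_norm] using this)
  have hclosed : IsClosed {y : OperatorFamily.{w} G | ∀ ξ : π.H, U (y π ξ) = y σ (U ξ)} := by
    simp only [Set.ofPred_forall]
    exact isClosed_iInter fun ξ => isClosed_eq (U.continuous.comp ((hev π).clm_apply
      continuous_const)) ((hev σ).clm_apply continuous_const)
  refine closure_minimal (fun y hy => ?_) hclosed x.2 ξ
  induction hy using NonUnitalStarAlgebra.adjoin_induction with
  | mem y hy =>
    obtain ⟨f, rfl⟩ := hy
    exact UnitaryRep.integrated_intertwine U hU f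
  | add y z _ _ hy hz => intro ξ; simp [hy ξ, hz ξ]
  | zero => intro ξ; simp
  | mul y z _ _ hy hz =>
    intro ξ
    change U (y π (z π ξ)) = y σ (z σ (U ξ))
    rw [hy, hz]
  | smul r y _ hy => intro ξ; simp [hy ξ]
  | star y _ hy =>
    intro ξ
    change U ((y π).adjoint ξ) = (y σ).adjoint (U ξ)
    refine ext_inner_right ℂ fun η => ?_
    obtain ⟨ζ, rfl⟩ := U.surjective η
    rw [LinearIsometryEquiv.inner_map_map, ContinuousLinearMap.adjoint_inner_left,
      ContinuousLinearMap.adjoint_inner_left, ← hy ζ, LinearIsometryEquiv.inner_map_map]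

end GroupCStar

/-! ### The unitary dual and the Fell topology -/

section Dual

/-- Unitary equivalence on irreducible unitary representations. -/
instance irrepSetoid (G : Type u) [Group G] [TopologicalSpace G] :
    Setoid {π : UnitaryRep.{w} G // π.IsIrreducible} where
  r π σ := UnitaryRep.Equivalent π.1 σ.1
  iseqv := ⟨fun π => .refl π.1, fun h => h.symm, fun h h' => h.trans h'⟩

/-- The unitary dual of `G`: equivalence classes of irreducible unitary representations. -/
def UnitaryDual (G : Type u) [Group G] [TopologicalSpace G] : Type (max u (w + 1)) :=
  Quotient (irrepSetoid.{w} G)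

/-- The class `[π]` of an irreducible unitary representation. -/
def UnitaryDual.mk {G : Type u} [Group G] [TopologicalSpace G] (π : UnitaryRep.{w} G)
    (h : π.IsIrreducible) : UnitaryDual.{w} G :=
  Quotient.mk _ ⟨π, h⟩

variable {G : Type u} [Group G] [TopologicalSpace G] [IsTopologicalGroup G]
  [LocallyCompactSpace G]

/-- The kernel in `C⋆(G)` of a class of irreducible representations (a primitive ideal). -/
def UnitaryDual.ker (z : UnitaryDual.{w} G) : Set (groupCStar.{w} G) :=
  Quotient.lift (fun π => {x | π.1.onCStar x = 0}) (by
    rintro π σ ⟨U, hU⟩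
    ext x
    constructor
    · intro (hx : π.1.onCStar x = 0)
      refine ContinuousLinearMap.ext fun η => ?_
      obtain ⟨ζ, rfl⟩ := U.surjective η
      rw [← UnitaryRep.onCStar_intertwine U hU, hx]
      simp
    · intro (hx : σ.1.onCStar x = 0)
      refine ContinuousLinearMap.ext fun ξ => U.injective ?_
      rw [UnitaryRep.onCStar_intertwine U hU, hx]
      simp) z

/-- The Fell topology on the unitary dual: the hull-kernel topology of the spectrum of `C⋆(G)`.
Its open sets are the complements of the hulls of ideals `I`, that is, the sets
`{z | ¬ I ⊆ ker z}`, which is the union over `x ∈ I` of the sets `{z | x ∉ ker z}` below. -/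
instance fellTopology : TopologicalSpace (UnitaryDual.{w} G) :=
  TopologicalSpace.generateFrom
    {U | ∃ x : groupCStar.{w} G, U = {z : UnitaryDual.{w} G | x ∉ z.ker}}

end Dual

end

/-! Well-definedness is Schur's lemma. An operator commuting with `π₁ ⊗ π₂` has slices `ξ ↦ ξ ⊗ η`,
`η ↦ ξ ⊗ η` that commute with `π₁` and `π₂`; all slices are scalar, hence so is the operator
(`UnitaryRep.IsIrreducible.tensor`).

Relative openness comes from restriction. For `x` in `C⋆(G₁)`, the family `pullback inl x` is a left
multiplier of `C⋆(G₁ × G₂)`, and multipliers define open sets of the dual just as elements do. It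
acts on `π₁ ⊗ π₂` as `x ⊗ 1`, so it vanishes there exactly when `x` vanishes on `π₁`. Thus every
subbasic open set of either factor is pulled back by `J` from an open set, which makes `J` inducing
once it is continuous (`UnitaryDual.isInducing_tensor`).

Continuity says that `x (π₁ ⊗ π₂) ≠ 0` persists near `([π₁], [π₂])`. Multiply `x` by a product `y`
of functions on the two factors; then `x * y` is a norm limit of linear combinations of translates
of `y`, and these act by finite sums of `a ⊗ b` with `a`, `b` in the two C⋆-algebras. The norm of
such a sum at `ξ ⊗ η` depends only on finitely many values of the vector states of `ξ` and `η`, and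
these values can be approximated by vector states of all nearby irreducible representations.

The last fact is the analytic core (`exists_forall_vectorState_close`). A vector state of an
irreducible representation is an extreme point of the compact convex set of states. Hahn–Banach
therefore yields one self-adjoint `h` that is positive on it and negative on every state deviating
from it on a given finite set. Any representation not killing `h⁺` has a vector state positive on
`h`, hence a close one. -/

noncomputable section

/-! ### Irreducible sets of operators and Schur's lemma -/

section Schur

variable {H : Type*} [NormedAddCommGroup H] [InnerProductSpace ℂ H]

/-- A set of operators is irreducible if its only closed invariant subspaces are trivial. -/
def IsIrreducibleSet (S : Set (H →L[ℂ] H)) : Prop :=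
  ∀ K : Submodule ℂ H, IsClosed (K : Set H) → (∀ a ∈ S, ∀ ξ ∈ K, a ξ ∈ K) → K = ⊥ ∨ K = ⊤

/-- Cyclicity of nonzero vectors. -/
theorem IsIrreducibleSet.eq_top_of_mem {S : Set (H →L[ℂ] H)}
    (hS : IsIrreducibleSet S) {K : Submodule ℂ H} (hK : ∀ a ∈ S, ∀ ξ ∈ K, a ξ ∈ K)
    {ξ : H} (hξ : ξ ∈ K) (h0 : ξ ≠ 0) : K.topologicalClosure = ⊤ := by
  rcases hS K.topologicalClosure K.isClosed_topologicalClosure (fun a ha x hx => by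
    exact map_mem_closure a.continuous hx (fun y hy => hK a ha y hy)) with h | h
  · have : ξ ∈ K.topologicalClosure := K.le_topologicalClosure hξ
    rw [h] at this
    exact absurd this h0
  · exact h

variable [CompleteSpace H]

/-- Two distinct spectral points would give two nonzero functions of `T` with product zero, and the
kernel of one of them would be a nontrivial closed invariant subspace. So the spectrum has at most
one point, and the functional calculus makes `T` scalar. -/
theorem IsIrreducibleSet.exists_eq_smul_of_isSelfAdjoint {S : Set (H →L[ℂ] H)}
    (hS : IsIrreducibleSet S) {T : H →L[ℂ] H} (hT : IsSelfAdjoint T)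
    (hcomm : ∀ a ∈ S, Commute T a) : ∃ c : ℂ, T = c • 1 := by
  by_cases hsub : (spectrum ℝ T).Subsingleton
  · rcases subsingleton_or_nontrivial H with h | h
    · exact ⟨0, ContinuousLinearMap.ext fun x => Subsingleton.elim _ _⟩
    · obtain ⟨a, ha⟩ := ContinuousFunctionalCalculus.spectrum_nonempty (R := ℝ) (p := IsSelfAdjoint) T hT
      refine ⟨a, ?_⟩
      have h1 : cfc (fun t : ℝ => t) T = cfc (fun _ : ℝ => a) T :=
        cfc_congr fun t ht => hsub ht ha
      rw [cfc_id' ℝ T, cfc_const a T] at h1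
      rw [h1]
      ext x
      simp [Algebra.algebraMap_eq_smul_one]
  · rw [Set.not_subsingleton_iff] at hsub
    obtain ⟨a, ha, b, hb, hab⟩ := hsub
    -- With half the distance as radius, the two tent functions have disjoint supports.
    set r : ℝ := |a - b| / 2
    have hr : 0 < r := half_pos (abs_pos.2 (sub_ne_zero.2 hab))
    let bump : ℝ → ℝ → ℝ := fun s t => max 0 (r - |t - s|)
    have hbump : ∀ s, Continuous (bump s) := fun s => by fun_prop
    have hne : ∀ s ∈ spectrum ℝ T, cfc (bump s) T ≠ 0 := by
      intro s hs h0
      have h2 : bump s s ∈ spectrum ℝ (cfc (bump s) T) := by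
        rw [cfc_map_spectrum (bump s) T hT (hbump s).continuousOn]
        exact ⟨s, hs, rfl⟩
      have : Nontrivial (H →L[ℂ] H) := by
        by_contra hn
        rw [not_nontrivial_iff_subsingleton] at hn
        simp [spectrum.of_subsingleton] at hs
      rw [h0, spectrum.zero_eq, Set.mem_singleton_iff] at h2
      simp only [bump, sub_self, abs_zero, sub_zero] at h2
      rw [max_eq_right hr.le] at h2
      exact hr.ne' h2
    have hmul : cfc (bump a) T * cfc (bump b) T = 0 := by
      rw [← cfc_mul _ _ T (hbump a).continuousOn (hbump b).continuousOn]
      have : (fun t => bump a t * bump b t) = fun _ => (0 : ℝ) := by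
        funext t
        simp only [bump]
        rcases le_total r |t - a| with h | h
        · rw [max_eq_left (by linarith), zero_mul]
        · have h3 : r ≤ |t - b| := by
            have h4 : |a - b| ≤ |t - a| + |t - b| := by
              have := abs_sub_le a t b
              rwa [abs_sub_comm a t] at this
            have h5 : |a - b| = 2 * r := by simp only [r]; ring
            linarith
          rw [max_eq_left (b := r - |t - b|) (by linarith), mul_zero]
      rw [this]
      exact cfc_zero ℝ T
    exfalso
    -- This kernel contains the range of `cfc (bump b) T`, so it is not `⊥`; it is not `⊤` because
    -- `cfc (bump a) T ≠ 0`.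
    rcases hS (LinearMap.ker (cfc (bump a) T : H →L[ℂ] H).toLinearMap)
      (cfc (bump a) T).isClosed_ker (fun c hc ξ hξ => by
        have hc' : Commute (cfc (bump a) T) c := Commute.cfc_real (hcomm c hc) (bump a)
        have h6 : cfc (bump a) T (c ξ) = c (cfc (bump a) T ξ) :=
          congrArg (fun S : H →L[ℂ] H => S ξ) hc'.eq
        have h7 : (cfc (bump a) T) ξ = 0 := hξ
        change (cfc (bump a) T) (c ξ) = 0
        rw [h6, h7, map_zero]) with h | h
    · refine hne b hb (ContinuousLinearMap.ext fun x => ?_)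
      have h8 : (cfc (bump b) T) x ∈ LinearMap.ker (cfc (bump a) T : H →L[ℂ] H).toLinearMap :=
        congrArg (fun S : H →L[ℂ] H => S x) hmul
      rw [h] at h8
      exact h8
    · refine hne a ha (ContinuousLinearMap.ext fun x => ?_)
      have h8 : x ∈ LinearMap.ker (cfc (bump a) T : H →L[ℂ] H).toLinearMap := h ▸ trivial
      exact h8

/-- Schur's lemma. -/
theorem IsIrreducibleSet.exists_eq_smul {S : Set (H →L[ℂ] H)}
    (hS : IsIrreducibleSet S) (hstar : ∀ a ∈ S, star a ∈ S) {T : H →L[ℂ] H}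
    (hcomm : ∀ a ∈ S, Commute T a) : ∃ c : ℂ, T = c • 1 := by
  have hcomm' : ∀ a ∈ S, Commute (star T) a := fun a ha => by
    have := (hcomm (star a) (hstar a ha)).star_star
    rwa [star_star] at this
  have hre : ∀ a ∈ S, Commute (realPart T : H →L[ℂ] H) a := fun a ha => by
    rw [realPart_apply_coe]
    exact ((hcomm a ha).add_left (hcomm' a ha)).smul_left _
  have him : ∀ a ∈ S, Commute (imaginaryPart T : H →L[ℂ] H) a := fun a ha => by
    rw [imaginaryPart_apply_coe]
    exact (((hcomm a ha).sub_left (hcomm' a ha)).smul_left _).smul_left _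
  obtain ⟨c, hc⟩ := hS.exists_eq_smul_of_isSelfAdjoint (realPart T).2 hre
  obtain ⟨d, hd⟩ := hS.exists_eq_smul_of_isSelfAdjoint (imaginaryPart T).2 him
  refine ⟨c + Complex.I * d, ?_⟩
  rw [← realPart_add_I_smul_imaginaryPart T, hc, hd, add_smul, mul_smul]

end Schur

/-! ### Separating an extreme point from finitely many compact convex sets -/

/-- Adjoin the sets one at a time by convex joins. An extreme point of `K` on a segment between two
points of `K` is one of its endpoints, so the join of two sets that miss `x` misses `x`. -/
theorem exists_isCompact_convex_of_extremePoint {E ι : Type*} [AddCommGroup E] [Module ℝ E]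
    [TopologicalSpace E] [ContinuousAdd E] [ContinuousSMul ℝ E] {K : Set E} (hK : Convex ℝ K)
    {x : E} (hx : x ∈ K.extremePoints ℝ) (C : ι → Set E) (s : Finset ι)
    (hcomp : ∀ i ∈ s, IsCompact (C i)) (hconv : ∀ i ∈ s, Convex ℝ (C i))
    (hsub : ∀ i ∈ s, C i ⊆ K) (hxC : ∀ i ∈ s, x ∉ C i) :
    ∃ D, IsCompact D ∧ Convex ℝ D ∧ D ⊆ K ∧ x ∉ D ∧ ∀ i ∈ s, C i ⊆ D := by
  classical
  induction s using Finset.induction_on with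
  | empty => exact ⟨∅, isCompact_empty, convex_empty, by simp, by simp, by simp⟩
  | insert i s his ih =>
    simp only [Finset.forall_mem_insert] at hcomp hconv hsub hxC
    obtain ⟨D, hD, hDc, hDK, hxD, hCD⟩ := ih hcomp.2 hconv.2 hsub.2 hxC.2
    -- A join with the empty set is empty and would lose the other set.
    rcases (C i).eq_empty_or_nonempty with h1 | h1
    · exact ⟨D, hD, hDc, hDK, hxD, by simpa [h1] using hCD⟩
    rcases D.eq_empty_or_nonempty with h2 | h2
    · refine ⟨C i, hcomp.1, hconv.1, hsub.1, hxC.1, ?_⟩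
      simp only [Finset.forall_mem_insert, subset_rfl, true_and]
      intro j hj
      refine (hCD j hj).trans ?_
      simp [h2]
    refine ⟨convexJoin ℝ D (C i), ?_, hDc.convexJoin hconv.1,
      convexJoin_subset hDK hsub.1 hK, ?_, ?_⟩
    · have himg : convexJoin ℝ D (C i) = (fun p : ℝ × E × E => (1 - p.1) • p.2.1 + p.1 • p.2.2) ''
          (Set.Icc (0 : ℝ) 1 ×ˢ D ×ˢ C i) := by
        ext y
        simp only [mem_convexJoin, segment_eq_image, Set.mem_image, Set.mem_prod, Prod.exists]
        constructor
        · rintro ⟨a, ha, b, hb, t, ht, rfl⟩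
          exact ⟨t, a, b, ⟨ht, ha, hb⟩, rfl⟩
        · rintro ⟨t, a, b, ⟨ht, ha, hb⟩, rfl⟩
          exact ⟨a, ha, b, hb, t, ht, rfl⟩
      rw [himg]
      exact (isCompact_Icc.prod (hD.prod hcomp.1)).image (by fun_prop)
    · intro hxJ
      obtain ⟨a, ha, b, hb, hxab⟩ := mem_convexJoin.1 hxJ
      by_cases hxa : a = x
      · exact hxD (hxa ▸ ha)
      by_cases hxb : b = x
      · exact hxC.1 (hxb ▸ hb)
      exact hxa ((mem_extremePoints.1 hx).2 a (hDK ha) b (hsub.1 hb)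
        (mem_openSegment_of_ne_left_right hxa hxb hxab)).1
    · simp only [Finset.forall_mem_insert]
      exact ⟨subset_convexJoin_right h2, fun j hj => (hCD j hj).trans (subset_convexJoin_left h1)⟩

/-- In a weak topology, an extreme point of a convex set is strictly separated from finitely many
compact convex subsets that do not contain it. -/
theorem WeakBilin.exists_forall_re_lt_of_extremePoint {E F ι : Type*} [AddCommGroup E] [Module ℂ E]
    [Module ℝ E] [IsScalarTower ℝ ℂ E] [AddCommGroup F] [Module ℂ F] {B : E →ₗ[ℂ] F →ₗ[ℂ] ℂ}
    (hB : B.SeparatingLeft) {K : Set (WeakBilin B)} (hK : Convex ℝ K) {ω : WeakBilin B}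
    (hω : ω ∈ K.extremePoints ℝ) (C : ι → Set (WeakBilin B)) (s : Finset ι)
    (hcomp : ∀ i ∈ s, IsCompact (C i)) (hconv : ∀ i ∈ s, Convex ℝ (C i))
    (hsub : ∀ i ∈ s, C i ⊆ K) (hωC : ∀ i ∈ s, ω ∉ C i) :
    ∃ (h : F) (c : ℝ), (∀ i ∈ s, ∀ ψ ∈ C i, (B ψ h).re < c) ∧ c < (B ω h).re := by
  have := IsScalarTower.continuousSMul (M := ℝ) (α := WeakBilin B) ℂ
  have : T2Space (WeakBilin B) :=
    (WeakBilin.isEmbedding (LinearMap.separatingLeft_iff_ker_eq_bot.1 hB |>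
      LinearMap.ker_eq_bot.1)).t2Space
  obtain ⟨D, hD, hDc, -, hωD, hCD⟩ :=
    exists_isCompact_convex_of_extremePoint hK hω C s hcomp hconv hsub hωC
  obtain ⟨f, c, hf, hc⟩ :=
    RCLike.geometric_hahn_banach_closed_point (𝕜 := ℂ) hDc hD.isClosed hωD
  obtain ⟨h, rfl⟩ := LinearMap.dualEmbedding_surjective B f
  exact ⟨h, c, fun i hi ψ hψ => hf ψ (hCD i hi hψ), hc⟩

/-- The weak-⋆ version of `WeakBilin.exists_forall_re_lt_of_extremePoint`. -/
theorem WeakDual.exists_forall_re_lt_of_extremePoint {E ι : Type*} [NormedAddCommGroup E]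
    [NormedSpace ℂ E] {K : Set (WeakDual ℂ E)} (hK : Convex ℝ K) {ω : WeakDual ℂ E}
    (hω : ω ∈ K.extremePoints ℝ) (C : ι → Set (WeakDual ℂ E)) (s : Finset ι)
    (hcomp : ∀ i ∈ s, IsCompact (C i)) (hconv : ∀ i ∈ s, Convex ℝ (C i))
    (hsub : ∀ i ∈ s, C i ⊆ K) (hωC : ∀ i ∈ s, ω ∉ C i) :
    ∃ (h : E) (c : ℝ), (∀ i ∈ s, ∀ ψ ∈ C i, (ψ h).re < c) ∧ c < (ω h).re :=
  WeakBilin.exists_forall_re_lt_of_extremePoint (B := topDualPairing ℂ E)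
    (fun _ hφ => ContinuousLinearMap.ext hφ) hK hω C s hcomp hconv hsub hωC

/-! ### States of a unital C⋆-algebra -/

section States

open scoped ComplexOrder

variable (M : Type*) [CStarAlgebra M]

/-- The states of a unital C⋆-algebra, as a subset of the dual with the weak-⋆ topology. -/
def stateSet : Set (WeakDual ℂ M) :=
  {φ | φ 1 = 1 ∧ (∀ a : M, 0 ≤ φ (star a * a)) ∧ ∀ a : M, ‖φ a‖ ≤ ‖a‖}

/-- This is Banach–Alaoglu. The norm bound in `stateSet` already follows from the other two
conditions; having it in the definition gives boundedness at once. -/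
theorem isCompact_stateSet : IsCompact (stateSet M) := by
  refine WeakDual.isCompact_of_bounded_of_closed ?_ ?_
  · refine (Metric.isBounded_closedBall (x := (0 : StrongDual ℂ M)) (r := 1)).subset ?_
    intro φ hφ
    rw [mem_closedBall_zero_iff]
    exact ContinuousLinearMap.opNorm_le_bound _ zero_le_one fun a => (hφ.2.2 a).trans_eq (one_mul _).symm
  · simp only [stateSet, Set.ofPred_and, Set.ofPred_forall]
    refine (isClosed_eq (WeakDual.eval_continuous _) continuous_const).inter
      ((isClosed_iInter fun a => ?_).inter (isClosed_iInter fun a => ?_))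
    · exact isClosed_le continuous_const (WeakDual.eval_continuous _)
    · exact isClosed_le (WeakDual.eval_continuous _).norm continuous_const

theorem convex_stateSet : Convex ℝ (stateSet M) := by
  intro φ hφ ψ hψ s t hs ht hst
  have happ : ∀ a : M, (s • φ + t • ψ) a = (s : ℂ) * φ a + (t : ℂ) * ψ a := fun a => rfl
  refine ⟨?_, fun a => ?_, fun a => ?_⟩
  · rw [happ, hφ.1, hψ.1, mul_one, mul_one, ← Complex.ofReal_add, hst, Complex.ofReal_one]
  · rw [happ]
    exact add_nonneg (mul_nonneg (by exact_mod_cast hs) (hφ.2.1 a))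
      (mul_nonneg (by exact_mod_cast ht) (hψ.2.1 a))
  · rw [happ]
    refine (norm_add_le _ _).trans ?_
    rw [norm_mul, norm_mul, Complex.norm_of_nonneg hs, Complex.norm_of_nonneg ht]
    calc s * ‖φ a‖ + t * ‖ψ a‖ ≤ s * ‖a‖ + t * ‖a‖ :=
          add_le_add (mul_le_mul_of_nonneg_left (hφ.2.2 a) hs)
            (mul_le_mul_of_nonneg_left (hψ.2.2 a) ht)
      _ = ‖a‖ := by rw [← add_mul, hst, one_mul]

variable {M}

variable {H : Type*} [NormedAddCommGroup H] [InnerProductSpace ℂ H] [CompleteSpace H]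

/-- The vector functional `a ↦ ⟪η, σ(a) η⟫`. -/
noncomputable def vectorFunctional (σ : M →⋆ₐ[ℂ] (H →L[ℂ] H)) (η : H) : WeakDual ℂ M :=
  StrongDual.toWeakDual (LinearMap.mkContinuous
    { toFun := fun a => inner ℂ η (σ a η)
      map_add' := fun a b => by simp
      map_smul' := fun c a => by simp } (‖η‖ ^ 2) (fun a => by
    change ‖inner ℂ η (σ a η)‖ ≤ _
    calc ‖inner ℂ η (σ a η)‖ ≤ ‖η‖ * (‖σ a‖ * ‖η‖) :=
          (norm_inner_le_norm _ _).trans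
            (mul_le_mul_of_nonneg_left ((σ a).le_opNorm η) (norm_nonneg _))
      _ ≤ ‖η‖ * (‖a‖ * ‖η‖) := by gcongr; exact NonUnitalStarAlgHom.norm_apply_le σ a
      _ = ‖η‖ ^ 2 * ‖a‖ := by ring))

@[simp] theorem vectorFunctional_apply (σ : M →⋆ₐ[ℂ] (H →L[ℂ] H)) (η : H) (a : M) :
    vectorFunctional σ η a = inner ℂ η (σ a η) := rfl

theorem inner_map_star_mul (σ : M →⋆ₐ[ℂ] (H →L[ℂ] H)) (ξ η : H) (a b : M) :
    inner ℂ ξ (σ (star a * b) η) = inner ℂ (σ a ξ) (σ b η) := by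
  have h : σ (star a * b) = star (σ a) * σ b := by
    rw [map_mul σ, map_star σ]
  rw [h, ContinuousLinearMap.star_eq_adjoint]
  exact ContinuousLinearMap.adjoint_inner_right (σ a) _ _

theorem vectorFunctional_mem_stateSet (σ : M →⋆ₐ[ℂ] (H →L[ℂ] H)) {η : H} (hη : ‖η‖ = 1) :
    vectorFunctional σ η ∈ stateSet M := by
  refine ⟨?_, fun a => ?_, fun a => ?_⟩
  · simp [inner_self_eq_norm_sq_to_K, hη]
  · rw [vectorFunctional_apply, inner_map_star_mul, inner_self_eq_norm_sq_to_K]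
    simp
  · have := (σ a).le_opNorm η
    rw [hη, mul_one] at this
    refine (norm_inner_le_norm _ _).trans ?_
    rw [hη, one_mul]
    exact this.trans (NonUnitalStarAlgHom.norm_apply_le σ a)

/-- A state dominated by a multiple of a vector state of an irreducible representation is that
vector state. -/
theorem eq_vectorFunctional_of_le {π : M →⋆ₐ[ℂ] (H →L[ℂ] H)}
    (hirr : IsIrreducibleSet (Set.range π)) {ξ : H} (hξ : ‖ξ‖ = 1) {φ : WeakDual ℂ M}
    (hφ : φ ∈ stateSet M) {s : ℝ} (hs : 0 < s)
    (hle : ∀ a : M, s * (φ (star a * a)).re ≤ (vectorFunctional π ξ (star a * a)).re) :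
    φ = vectorFunctional π ξ := by
  let : PartialOrder M := CStarAlgebra.spectralOrder M
  have : StarOrderedRing M := CStarAlgebra.spectralOrderedRing M
  let f : M →ₚ[ℂ] ℂ := PositiveLinearMap.mk₀ (WeakDual.toStrongDual φ).toLinearMap (by
    intro x hx
    obtain ⟨b, rfl⟩ := CStarAlgebra.nonneg_iff_eq_star_mul_self.1 hx
    exact hφ.2.1 b)
  have hf : ∀ a, f a = φ a := fun a => rfl
  let e : M →ₗ[ℂ] H :=
    { toFun := fun a => π a ξ
      map_add' := fun a b => by simp
      map_smul' := fun c a => by simp }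
  let g : M →ₗ[ℂ] f.GNS := (UniformSpace.Completion.toComplₗᵢ (𝕜 := ℂ) (E := f.PreGNS)).toLinearMap
    ∘ₗ f.toPreGNS.toLinearMap
  have hg : ∀ a b : M, inner ℂ (g a) (g b) = φ (star a * b) := fun a b => by
    change inner ℂ ((f.toPreGNS a : f.GNS)) ((f.toPreGNS b : f.GNS)) = _
    rw [UniformSpace.Completion.inner_coe]
    rfl
  have he : DenseRange e := by
    have h0 : ξ ≠ 0 := fun h => by simp [h] at hξ
    have h1 := hirr.eq_top_of_mem (K := LinearMap.range e) (by
      rintro _ ⟨a, rfl⟩ _ ⟨b, rfl⟩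
      exact ⟨a * b, by simp [e]⟩) (ξ := ξ) ⟨1, by simp [e]⟩ h0
    have h2 := Submodule.dense_iff_topologicalClosure_eq_top.2 h1
    rwa [LinearMap.coe_range] at h2
  -- The domination hypothesis says exactly that `π a ξ ↦ [a]`, into the GNS space of `φ`, is
  -- bounded by `s ^ (-1/2)`.
  have hnorm : ∃ C, ∀ a, ‖g a‖ ≤ C * ‖e a‖ := by
    refine ⟨Real.sqrt s⁻¹, fun a => ?_⟩
    have h1 : ‖g a‖ ^ 2 = (φ (star a * a)).re := by
      rw [← hg, inner_self_eq_norm_sq_to_K]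
      norm_cast
    have h2 : ‖e a‖ ^ 2 = (vectorFunctional π ξ (star a * a)).re := by
      rw [vectorFunctional_apply, inner_map_star_mul, inner_self_eq_norm_sq_to_K]
      norm_cast
    have h3 := hle a
    rw [← h1, ← h2] at h3
    refine le_of_sq_le_sq ?_ (by positivity)
    rw [mul_pow, Real.sq_sqrt (by positivity), inv_mul_eq_div, le_div_iff₀ hs, mul_comm]
    exact h3
  let W : H →L[ℂ] f.GNS := g.extendOfNorm e
  have hW : ∀ a, W (π a ξ) = g a := fun a => LinearMap.extendOfNorm_eq he hnorm a
  -- `T` is the Radon–Nikodym derivative of `φ` with respect to the vector state. It commutes with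
  -- `π`, so Schur makes it a scalar, which the value at `1` determines.
  let T : H →L[ℂ] H := W.adjoint ∘L W
  have hT : ∀ a b : M, inner ℂ (π a ξ) (T (π b ξ)) = φ (star a * b) := fun a b => by
    change inner ℂ (π a ξ) (W.adjoint (W (π b ξ))) = _
    rw [ContinuousLinearMap.adjoint_inner_right, hW, hW, hg]
  obtain ⟨c, hc⟩ := hirr.exists_eq_smul (T := T) (by
      rintro _ ⟨a, rfl⟩
      exact ⟨star a, map_star π a⟩) (by
    rintro _ ⟨b, rfl⟩
    refine ContinuousLinearMap.ext fun x => ?_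
    refine he.induction_on (p := fun x => (T * π b) x = (π b * T) x) x
      (isClosed_eq (T * π b).continuous (π b * T).continuous) fun a => ?_
    refine he.eq_of_inner_right ℂ ?_
    intro d
    change inner ℂ (π d ξ) (T (π b (π a ξ))) = inner ℂ (π d ξ) (π b (T (π a ξ)))
    have h1 : π b (π a ξ) = π (b * a) ξ := by simp
    have h2 : inner ℂ (π d ξ) (π b (T (π a ξ))) = inner ℂ (π (star b * d) ξ) (T (π a ξ)) := by
      have := inner_map_star_mul π (π d ξ) (T (π a ξ)) (star b) 1
      rw [star_star, mul_one, map_one] at this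
      rw [this]
      simp
    rw [h1, h2, hT, hT]
    simp [mul_assoc])
  have key : ∀ a, φ a = c * vectorFunctional π ξ a := fun a => by
    have h1 := hT 1 a
    rw [star_one, one_mul, hc] at h1
    rw [← h1]
    simp
  have hc1 : c = 1 := by
    have h1 := key 1
    rw [hφ.1, (vectorFunctional_mem_stateSet π hξ).1, mul_one] at h1
    exact h1.symm
  refine DFunLike.ext _ _ fun a => ?_
  rw [key, hc1, one_mul]

/-- If the vector state is `s φ + t ψ`, then it dominates `s φ` because `t ψ` is positive, so
`eq_vectorFunctional_of_le` applies to `φ`. -/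
theorem vectorFunctional_mem_extremePoints {π : M →⋆ₐ[ℂ] (H →L[ℂ] H)}
    (hirr : IsIrreducibleSet (Set.range π)) {ξ : H} (hξ : ‖ξ‖ = 1) :
    vectorFunctional π ξ ∈ (stateSet M).extremePoints ℝ := by
  refine mem_extremePoints_iff_left.2 ⟨vectorFunctional_mem_stateSet π hξ, ?_⟩
  rintro φ hφ ψ hψ ⟨s, t, hs, ht, -, hst⟩
  refine eq_vectorFunctional_of_le hirr hξ hφ hs fun a => ?_
  have h1 : vectorFunctional π ξ (star a * a)
      = (s : ℂ) * φ (star a * a) + (t : ℂ) * ψ (star a * a) := by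
    rw [← hst]; rfl
  rw [h1, Complex.add_re, Complex.re_ofReal_mul, Complex.re_ofReal_mul]
  have h2 := (Complex.le_def.1 (hψ.2.1 a)).1
  have h3 : 0 ≤ t * (ψ (star a * a)).re := mul_nonneg ht.le h2
  linarith

/-- Write `h⁺ = q⋆ q`. Then `h⁺ h h⁺ = (q h⁺)⋆ (q h⁺)`, so `η = σ h⁺ v` has `⟪η, σ h η⟫ = ‖σ (q h⁺)
v‖²`. Some `v` makes this positive, since `σ (q h⁺) = 0` would force `(σ h⁺)² = 0`. -/
theorem exists_inner_pos_of_map_posPart_ne_zero {σ : M →⋆ₐ[ℂ] (H →L[ℂ] H)} {h : M}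
    (hh : IsSelfAdjoint h) (hσ : σ h⁺ ≠ 0) : ∃ η : H, ‖η‖ = 1 ∧ 0 < (inner ℂ η (σ h η)).re := by
  let : PartialOrder M := CStarAlgebra.spectralOrder M
  have : StarOrderedRing M := CStarAlgebra.spectralOrderedRing M
  obtain ⟨q, hq⟩ := CStarAlgebra.nonneg_iff_eq_star_mul_self.1 (CFC.posPart_nonneg h)
  have hsa : star h⁺ = h⁺ := (CFC.posPart_nonneg h).isSelfAdjoint
  have hcube : star h⁺ * (h * h⁺) = star (q * h⁺) * (q * h⁺) := by
    rw [star_mul, hsa, mul_assoc, ← mul_assoc (star q), ← hq]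
    nth_rewrite 2 [← CFC.posPart_sub_negPart h hh]
    rw [sub_mul, CFC.negPart_mul_posPart, sub_zero]
  have hne : σ (q * h⁺) ≠ 0 := by
    intro h0
    have h1 : star (σ h⁺) * σ h⁺ = 0 := by
      rw [← map_star σ, hsa]
      nth_rewrite 1 [hq]
      rw [← map_mul σ, mul_assoc, map_mul σ, h0, mul_zero]
    exact hσ (CStarRing.star_mul_self_eq_zero_iff _ |>.1 h1)
  obtain ⟨v, hv⟩ : ∃ v, σ (q * h⁺) v ≠ 0 := by
    by_contra! hcon
    exact hne (ContinuousLinearMap.ext hcon)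
  set η := σ h⁺ v with hηdef
  have hη : η ≠ 0 := fun h0 => hv (by
    rw [map_mul σ, mul_apply_eq_comp, ← hηdef, h0, map_zero])
  have h2 : inner ℂ η (σ h η) = (‖σ (q * h⁺) v‖ ^ 2 : ℂ) := by
    have h3 := inner_map_star_mul σ v v h⁺ (h * h⁺)
    rw [hcube, inner_map_star_mul, inner_self_eq_norm_sq_to_K] at h3
    have h4 : σ (h * h⁺) v = σ h η := by rw [map_mul σ]; rfl
    rw [h4] at h3
    exact h3.symm
  refine ⟨(‖η‖⁻¹ : ℂ) • η, ?_, ?_⟩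
  · rw [norm_smul, norm_inv, Complex.norm_real, norm_norm, inv_mul_cancel₀ (norm_ne_zero_iff.2 hη)]
  · rw [map_smul, inner_smul_left, inner_smul_right, h2, map_inv₀, Complex.conj_ofReal]
    have h5 : 0 < ‖η‖⁻¹ * (‖η‖⁻¹ * ‖σ (q * h⁺) v‖ ^ 2) := by positivity
    exact_mod_cast h5

theorem re_inner_map_realPart_sub (σ : M →⋆ₐ[ℂ] (H →L[ℂ] H)) {η : H} (hη : ‖η‖ = 1) (a : M)
    (c : ℝ) : (inner ℂ η (σ ((realPart a : M) - algebraMap ℝ M c) η)).re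
      = (vectorFunctional σ η a).re - c := by
  have h1 : inner ℂ η (σ (star a) η) = star (inner ℂ η (σ a η)) := by
    have := inner_map_star_mul σ η η a 1
    rw [mul_one, map_one σ] at this
    rw [this]
    exact (inner_conj_symm _ _).symm
  have h2 : σ (algebraMap ℝ M c) η = (c : ℂ) • η := by
    rw [IsScalarTower.algebraMap_apply ℝ ℂ M, AlgHomClass.commutes σ]
    rfl
  have h3 : σ (realPart a : M) η = (2⁻¹ : ℂ) • (σ a η + σ (star a) η) := by
    have : (realPart a : M) = (2⁻¹ : ℂ) • (a + star a) := by
      rw [realPart_apply_coe, ← Complex.coe_smul]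
      norm_num
    rw [this, map_smul σ, map_add σ]
    rfl
  rw [map_sub σ, sub_apply, h2, h3, inner_sub_right, inner_smul_right,
    inner_smul_right, inner_add_right, h1, inner_self_eq_norm_sq_to_K, hη]
  have h4 : ∀ z : ℂ, ((2⁻¹ : ℂ) * (z + star z)).re = z.re := fun z => by
    rw [Complex.star_def, Complex.add_conj]
    simp
  rw [Complex.sub_re, h4]
  simp

universe w' in
/-- Vector states of an irreducible representation `π` are approximated by vector states of all
representations outside a hull whose complement contains `π`. -/
theorem exists_forall_vectorState_close {π : M →⋆ₐ[ℂ] (H →L[ℂ] H)}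
    (hirr : IsIrreducibleSet (Set.range π)) {ξ : H} (hξ : ‖ξ‖ = 1) (F : Finset M) {ε : ℝ}
    (hε : 0 < ε) : ∃ e : M, π e ≠ 0 ∧
      ∀ (L : Type w') [NormedAddCommGroup L] [InnerProductSpace ℂ L] [CompleteSpace L]
        (σ : M →⋆ₐ[ℂ] (L →L[ℂ] L)), σ e ≠ 0 →
        ∃ η : L, ‖η‖ = 1 ∧ ∀ a ∈ F, ‖inner ℂ η (σ a η) - inner ℂ ξ (π a ξ)‖ < ε := by
  classical
  let : PartialOrder M := CStarAlgebra.spectralOrder M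
  have : StarOrderedRing M := CStarAlgebra.spectralOrderedRing M
  set ω := vectorFunctional π ξ with hω
  -- States that deviate from `ω` at `p.1` by at least `ε / 2` in the direction selected by `p.2`.
  -- The four directions `±1, ±I` bound real and imaginary parts, and each set is compact, convex
  -- and misses `ω`.
  let C : M × ℂ → Set (WeakDual ℂ M) := fun p =>
    stateSet M ∩ {ψ | ε / 2 ≤ (p.2 * (ψ p.1 - ω p.1)).re}
  have hcont : ∀ p : M × ℂ, Continuous fun ψ : WeakDual ℂ M => (p.2 * (ψ p.1 - ω p.1)).re :=
    fun p => Complex.continuous_re.comp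
      (continuous_const.mul ((WeakDual.eval_continuous p.1).sub continuous_const))
  obtain ⟨h₀, c, hClt, hlt⟩ := WeakDual.exists_forall_re_lt_of_extremePoint (convex_stateSet M)
    (vectorFunctional_mem_extremePoints hirr hξ) C
    (F ×ˢ ({1, -1, Complex.I, -Complex.I} : Finset ℂ))
    (fun p _ => (isCompact_stateSet M).inter_right (isClosed_le continuous_const (hcont p)))
    (fun p _ => by
      refine (convex_stateSet M).inter ?_
      intro φ hφ ψ hψ s t hs ht hst
      have happ : (s • φ + t • ψ) p.1 = (s : ℂ) * φ p.1 + (t : ℂ) * ψ p.1 := rfl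
      have h1 : p.2 * ((s • φ + t • ψ) p.1 - ω p.1)
          = (s : ℂ) * (p.2 * (φ p.1 - ω p.1)) + (t : ℂ) * (p.2 * (ψ p.1 - ω p.1)) := by
        have h2 : (s : ℂ) + t = 1 := by exact_mod_cast hst
        rw [happ]
        linear_combination (p.2 * ω p.1) * h2
      change ε / 2 ≤ (p.2 * ((s • φ + t • ψ) p.1 - ω p.1)).re
      rw [h1, Complex.add_re, Complex.re_ofReal_mul, Complex.re_ofReal_mul]
      calc ε / 2 = s * (ε / 2) + t * (ε / 2) := by rw [← add_mul, hst, one_mul]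
        _ ≤ _ := add_le_add (mul_le_mul_of_nonneg_left hφ hs) (mul_le_mul_of_nonneg_left hψ ht))
    (fun p _ => Set.inter_subset_left)
    (fun p _ h => by
      have h1 : ε / 2 ≤ (p.2 * (ω p.1 - ω p.1)).re := h.2
      rw [sub_self, mul_zero, Complex.zero_re] at h1
      linarith)
  set h : M := (realPart h₀ : M) - algebraMap ℝ M c with hh
  have hsa : IsSelfAdjoint h := (realPart h₀).2.sub (IsSelfAdjoint.algebraMap M (.all c))
  -- If `π h⁺ = 0`, then `ω h ≤ 0`, against the separation. If `σ h⁺ ≠ 0`, some vector state of `σ`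
  -- is positive on `h` and so avoids every `C p`.
  refine ⟨h⁺, fun h0 => ?_, fun L _ _ _ σ hσ => ?_⟩
  · have h1 : (inner ℂ ξ (π h ξ)).re = (vectorFunctional π ξ h₀).re - c :=
      re_inner_map_realPart_sub π hξ h₀ c
    obtain ⟨q, hq⟩ := CStarAlgebra.nonneg_iff_eq_star_mul_self.1 (CFC.negPart_nonneg h)
    have h2 : (inner ℂ ξ (π h ξ)).re = -‖π q ξ‖ ^ 2 := by
      rw [← CFC.posPart_sub_negPart h hsa, map_sub π, h0, zero_sub, neg_apply,
        inner_neg_right, hq, inner_map_star_mul, inner_self_eq_norm_sq_to_K]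
      norm_cast
    have h3 := sq_nonneg ‖π q ξ‖
    linarith
  · obtain ⟨η, hη, hpos⟩ := exists_inner_pos_of_map_posPart_ne_zero hsa hσ
    have h1 : (inner ℂ η (σ h η)).re = (vectorFunctional σ η h₀).re - c :=
      re_inner_map_realPart_sub σ hη h₀ c
    have hnot : ∀ p ∈ F ×ˢ ({1, -1, Complex.I, -Complex.I} : Finset ℂ),
        (p.2 * (vectorFunctional σ η p.1 - ω p.1)).re < ε / 2 := by
      intro p hp
      by_contra! hcon
      have := hClt p hp _ ⟨vectorFunctional_mem_stateSet σ hη, hcon⟩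
      linarith
    refine ⟨η, hη, fun a ha => ?_⟩
    set z : ℂ := vectorFunctional σ η a - ω a
    have h2 : ∀ c ∈ ({1, -1, Complex.I, -Complex.I} : Finset ℂ), (c * z).re < ε / 2 :=
      fun c hc => hnot (a, c) (Finset.mk_mem_product ha hc)
    simp only [Finset.mem_insert, Finset.mem_singleton, forall_eq_or_imp, forall_eq, one_mul,
      neg_mul, Complex.neg_re, Complex.I_mul_re, neg_neg] at h2
    obtain ⟨h3, h4, h5, h6⟩ := h2
    change ‖z‖ < ε
    calc ‖z‖ ≤ |z.re| + |z.im| := Complex.norm_le_abs_re_add_abs_im z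
      _ < ε / 2 + ε / 2 := add_lt_add (abs_lt.2 ⟨by linarith, h3⟩) (abs_lt.2 ⟨by linarith, h6⟩)
      _ = ε := add_halves ε

end States

/-! ### Translation operators and the universal representation -/

/-- The integral can be computed inside the complete space `K`, and the inclusion of `K` commutes
with integration. -/
theorem integral_smul_mem {X E : Type*} [MeasurableSpace X] {μ : Measure X}
    [NormedAddCommGroup E] [NormedSpace ℂ E] [CompleteSpace E] (K : Submodule ℂ E)
    (hK : IsClosed (K : Set E)) {F : X → E} (hF : Integrable F μ) (hmem : ∀ x, F x ∈ K) :
    ∫ x, F x ∂μ ∈ K := by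
  have := hK.completeSpace_coe
  let F' : X → K := fun x => ⟨F x, hmem x⟩
  have h1 := K.subtypeL.integral_comp_comm (μ := μ) (φ := F') (by
    refine ⟨?_, ?_⟩
    · exact (Topology.IsEmbedding.subtypeVal.aestronglyMeasurable_comp_iff).1 hF.1
    · exact hF.2)
  have h2 : ∫ x, F x ∂μ = K.subtypeL (∫ x, F' x ∂μ) := h1
  rw [h2]
  exact (∫ x, F' x ∂μ).2

section Translation

variable {G : Type u} [Group G] [TopologicalSpace G]

/-! Shortcut instances, without which instance search on `OperatorFamily` is slow. -/

section Instances

set_option synthInstance.maxHeartbeats 200000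

instance : NonUnitalCStarAlgebra (OperatorFamily.{w} G) := inferInstance

instance : NonUnitalNormedRing (OperatorFamily.{w} G) := inferInstance

instance : NonUnitalRing (OperatorFamily.{w} G) := inferInstance

instance : NonUnitalNonAssocRing (OperatorFamily.{w} G) := inferInstance

instance : NonUnitalSemiring (OperatorFamily.{w} G) := inferInstance

instance : NonUnitalNonAssocSemiring (OperatorFamily.{w} G) := inferInstance

instance : NormedAddCommGroup (OperatorFamily.{w} G) := inferInstance

instance : SeminormedAddCommGroup (OperatorFamily.{w} G) := inferInstance

instance : AddGroup (OperatorFamily.{w} G) := inferInstance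

instance : AddCommMonoid (OperatorFamily.{w} G) := inferInstance

instance : AddMonoid (OperatorFamily.{w} G) := inferInstance

instance : AddZeroClass (OperatorFamily.{w} G) := inferInstance

instance : UniformSpace (OperatorFamily.{w} G) := inferInstance

instance : TopologicalSpace (OperatorFamily.{w} G) := inferInstance

instance : NormedSpace ℂ (OperatorFamily.{w} G) := inferInstance

instance : Module ℂ (OperatorFamily.{w} G) := inferInstance

instance : SMul ℂ (OperatorFamily.{w} G) := inferInstance

instance : Norm (OperatorFamily.{w} G) := inferInstance

instance : Mul (OperatorFamily.{w} G) := inferInstance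

instance : Star (OperatorFamily.{w} G) := inferInstance

end Instances

/-- The family of operators `(π(g))_π`. -/
def transl (g : G) : OperatorFamily.{w} G :=
  ⟨fun π => ((π.op g).toContinuousLinearEquiv : π.H →L[ℂ] π.H), memℓp_infty ⟨1, by
    rintro _ ⟨π, rfl⟩
    exact (π.op g).toLinearIsometry.norm_toContinuousLinearMap_le⟩⟩

@[simp] theorem transl_apply (g : G) (π : UnitaryRep.{w} G) (ξ : π.H) :
    (transl g : OperatorFamily.{w} G) π ξ = π.op g ξ := rfl

theorem OperatorFamily.ext {x y : OperatorFamily.{w} G}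
    (h : ∀ (π : UnitaryRep.{w} G) (ξ : π.H), x π ξ = y π ξ) : x = y :=
  lp.ext (funext fun π => ContinuousLinearMap.ext (h π))

@[simp] theorem OperatorFamily.mul_apply (x y : OperatorFamily.{w} G) (π : UnitaryRep.{w} G)
    (ξ : π.H) : (x * y) π ξ = x π (y π ξ) := rfl

theorem transl_mul (g h : G) : (transl (g * h) : OperatorFamily.{w} G) = transl g * transl h :=
  OperatorFamily.ext fun π ξ => by simp

theorem transl_one_mul (x : OperatorFamily.{w} G) : transl 1 * x = x :=
  OperatorFamily.ext fun π ξ => by simp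

theorem UnitaryRep.adjoint_op (π : UnitaryRep.{w} G) (g : G) :
    ((π.op g).toContinuousLinearEquiv : π.H →L[ℂ] π.H).adjoint
      = ((π.op g⁻¹).toContinuousLinearEquiv : π.H →L[ℂ] π.H) := by
  symm
  rw [ContinuousLinearMap.eq_adjoint_iff]
  intro ξ η
  change inner ℂ (π.op g⁻¹ ξ) η = inner ℂ ξ (π.op g η)
  have h : π.op g (π.op g⁻¹ ξ) = ξ := by
    change (π.op g * π.op g⁻¹) ξ = ξ
    rw [← map_mul]
    simp
  rw [← LinearIsometryEquiv.inner_map_map (π.op g), h]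

/-- Evaluation of a family of operators at a representation and a vector. -/
def evalVec (π : UnitaryRep.{w} G) (ξ : π.H) : OperatorFamily.{w} G →L[ℂ] π.H :=
  (ContinuousLinearMap.apply ℂ π.H ξ).comp
    (lp.evalCLM ℂ (fun π : UnitaryRep.{w} G => π.H →L[ℂ] π.H) ∞ π)

theorem continuous_eval (π : UnitaryRep.{w} G) : Continuous fun x : OperatorFamily.{w} G => x π :=
  (lp.evalCLM ℂ (fun π : UnitaryRep.{w} G => π.H →L[ℂ] π.H) ∞ π).continuous

/-- The closed linear span of the translates of a family of operators. -/
def translSpan (y : OperatorFamily.{w} G) : Submodule ℂ (OperatorFamily.{w} G) :=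
  (Submodule.span ℂ (Set.range fun g : G => transl g * y)).topologicalClosure

theorem transl_mul_mem_translSpan (y : OperatorFamily.{w} G) (g : G) :
    transl g * y ∈ translSpan y :=
  Submodule.le_topologicalClosure _ (Submodule.subset_span ⟨g, rfl⟩)

theorem self_mem_translSpan (y : OperatorFamily.{w} G) : y ∈ translSpan y := by
  simpa [transl_one_mul] using transl_mul_mem_translSpan y 1

theorem isClosed_translSpan (y : OperatorFamily.{w} G) :
    IsClosed (translSpan y : Set (OperatorFamily.{w} G)) :=
  Submodule.isClosed_topologicalClosure _

end Translation

/-! ### Translates and approximate units for compactly supported functions -/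

section UniversalRep

variable {G : Type u} [Group G] [TopologicalSpace G] [IsTopologicalGroup G]
  [LocallyCompactSpace G]

/-- The left translate `x ↦ f (g⁻¹ x)`. -/
def leftTranslate (g : G) (f : C_c(G, ℂ)) : C_c(G, ℂ) :=
  ⟨⟨fun x => f (g⁻¹ * x), f.continuous.comp (continuous_const_mul _)⟩,
    f.hasCompactSupport.comp_homeomorph (Homeomorph.mulLeft g⁻¹)⟩

theorem universalRep_apply (f : C_c(G, ℂ)) (π : UnitaryRep.{w} G) :
    (universalRep f : OperatorFamily.{w} G) π = π.integrated f := rfl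

/-- This is left invariance of Haar measure. It makes each `transl g` a left multiplier of the image
of `C_c(G, ℂ)`. -/
theorem transl_mul_universalRep (g : G) (f : C_c(G, ℂ)) :
    (transl g * universalRep f : OperatorFamily.{w} G) = universalRep (leftTranslate g f) := by
  refine OperatorFamily.ext fun π ξ => ?_
  let : MeasurableSpace G := borel G
  have : BorelSpace G := ⟨rfl⟩
  have h1 : π.op g (∫ x, f x • π.op x ξ ∂(UnitaryRep.leftHaar G))
      = ∫ x, π.op g (f x • π.op x ξ) ∂(UnitaryRep.leftHaar G) :=
    (((π.op g).toContinuousLinearEquiv : π.H →L[ℂ] π.H).integral_comp_comm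
      (π.integrable_smul_op f ξ)).symm
  have h2 := integral_mul_left_eq_self (μ := (Measure.haar : Measure G))
    (fun x => f (g⁻¹ * x) • π.op x ξ) g
  rw [OperatorFamily.mul_apply, transl_apply, universalRep_apply, universalRep_apply,
    UnitaryRep.integrated_apply, UnitaryRep.integrated_apply, h1]
  refine Eq.trans ?_ h2
  refine integral_congr_ae (.of_forall fun x => ?_)
  simp

theorem norm_universalRep_sub_le (f₁ f₂ : C_c(G, ℂ)) :
    ‖(universalRep f₁ - universalRep f₂ : OperatorFamily.{w} G)‖
      ≤ ∫ g, ‖f₁ g - f₂ g‖ ∂(UnitaryRep.leftHaar G) := by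
  refine lp.norm_le_of_forall_le (integral_nonneg fun _ => norm_nonneg _) fun π => ?_
  have : (universalRep f₁ - universalRep f₂ : OperatorFamily.{w} G) π = π.integrated (f₁ - f₂) := by
    refine ContinuousLinearMap.ext fun ξ => ?_
    change π.integrated f₁ ξ - π.integrated f₂ ξ = π.integrated (f₁ - f₂) ξ
    rw [UnitaryRep.integrated_apply, UnitaryRep.integrated_apply, UnitaryRep.integrated_apply,
      ← integral_sub (π.integrable_smul_op f₁ ξ) (π.integrable_smul_op f₂ ξ)]
    simp [sub_smul]
  rw [this]
  exact π.norm_integrated_le (f₁ - f₂)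

/-- Left translation of `f` is continuous in `L¹`, which dominates the norm here. The map `transl`
alone need not be norm continuous, so later arguments always keep a right factor. -/
theorem continuous_transl_mul_universalRep (f : C_c(G, ℂ)) :
    Continuous fun g : G => (transl g * universalRep f : OperatorFamily.{w} G) := by
  rw [continuous_iff_continuousAt]
  intro g₀
  let : MeasurableSpace G := borel G
  have : BorelSpace G := ⟨rfl⟩
  obtain ⟨V, hV, hVn⟩ := exists_compact_mem_nhds g₀
  -- For `g` in the compact neighbourhood `V`, all integrands vanish off the compact set `V *
  -- tsupport f`.
  have hcont : ContinuousOn (fun g => ∫ x, ‖f (g⁻¹ * x) - f (g₀⁻¹ * x)‖ ∂(Measure.haar : Measure G))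
      V := by
    refine continuousOn_integral_of_compact_support
      (k := (fun p : G × G => p.1 * p.2) '' (V ×ˢ tsupport f))
      ((hV.prod f.hasCompactSupport).image continuous_mul) ?_ ?_
    · refine Continuous.continuousOn ?_
      exact ((f.continuous.comp (continuous_fst.inv.mul continuous_snd)).sub
        (f.continuous.comp (continuous_const.mul continuous_snd))).norm
    · intro g x hg hx
      have hz : ∀ r ∈ V, f (r⁻¹ * x) = 0 := fun r hr => by
        by_contra h
        exact hx ⟨(r, r⁻¹ * x), ⟨hr, subset_tsupport _ h⟩, by simp⟩
      rw [hz g hg, hz g₀ (mem_of_mem_nhds hVn), sub_self, norm_zero]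
  have hcont' := (hcont g₀ (mem_of_mem_nhds hVn)).continuousAt hVn
  rw [ContinuousAt, tendsto_iff_norm_sub_tendsto_zero]
  have h0 : Filter.Tendsto
      (fun g => ∫ x, ‖f (g⁻¹ * x) - f (g₀⁻¹ * x)‖ ∂(Measure.haar : Measure G)) (𝓝 g₀) (𝓝 0) := by
    simpa [ContinuousAt] using hcont'
  refine squeeze_zero (fun _ => norm_nonneg _) (fun g => ?_) h0
  rw [transl_mul_universalRep, transl_mul_universalRep]
  exact norm_universalRep_sub_le _ _

/-- The integrated form is nondegenerate. -/
theorem UnitaryRep.exists_norm_integrated_sub_lt (π : UnitaryRep.{w} G) (ξ : π.H) {ε : ℝ}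
    (hε : 0 < ε) : ∃ f : C_c(G, ℂ), ‖π.integrated f ξ - ξ‖ < ε := by
  let : MeasurableSpace G := borel G
  have : BorelSpace G := ⟨rfl⟩
  let μ : Measure G := Measure.haar
  let U : Set G := {g | ‖π.op g ξ - ξ‖ < ε / 2}
  have hU : IsOpen U :=
    isOpen_lt (((π.continuous_op ξ).sub continuous_const).norm) continuous_const
  have h1U : (1 : G) ∈ U := by
    change ‖π.op 1 ξ - ξ‖ < ε / 2
    simp only [map_one, LinearIsometryEquiv.coe_one, id_eq, sub_self, norm_zero]
    exact half_pos hε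
  obtain ⟨f, hf1, hf0, hfc, hf01⟩ := exists_continuous_one_zero_of_isCompact
    (isCompact_singleton (x := (1 : G))) hU.isClosed_compl
    (Set.disjoint_singleton_left.2 fun h => h h1U)
  have hpos : 0 < ∫ x, f x ∂μ := by
    refine f.continuous.integral_pos_of_hasCompactSupport_nonneg_nonzero hfc
      (fun x => (hf01 x).1) (x := 1) ?_
    rw [hf1 rfl]
    exact one_ne_zero
  set c : ℝ := ∫ x, f x ∂μ with hc
  have hcs : HasCompactSupport fun x => ((c⁻¹ * f x : ℝ) : ℂ) :=
    (hfc.mul_left (f := fun _ => c⁻¹)).comp_left (g := ((↑) : ℝ → ℂ)) Complex.ofReal_zero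
  -- A nonnegative bump of integral one that vanishes wherever `π.op` moves `ξ` by at least `ε / 2`.
  let φ : C_c(G, ℂ) := ⟨⟨fun x => ((c⁻¹ * f x : ℝ) : ℂ),
    Complex.continuous_ofReal.comp (continuous_const.mul f.continuous)⟩, hcs⟩
  have hφ : ∀ x, φ x = ((c⁻¹ * f x : ℝ) : ℂ) := fun _ => rfl
  have hφint : ∫ x, φ x ∂μ = 1 := by
    have h : ∫ x, φ x ∂μ = ((∫ x, c⁻¹ * f x ∂μ : ℝ) : ℂ) := integral_ofReal
    rw [h, integral_const_mul, ← hc, inv_mul_cancel₀ hpos.ne', Complex.ofReal_one]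
  have hint : Integrable (fun x => φ x) μ :=
    φ.continuous.integrable_of_hasCompactSupport φ.hasCompactSupport
  refine ⟨φ, ?_⟩
  have h2 : π.integrated φ ξ - ξ = ∫ x, φ x • (π.op x ξ - ξ) ∂μ := by
    have i1 : Integrable (fun x => φ x • π.op x ξ) μ := π.integrable_smul_op φ ξ
    simp only [smul_sub]
    rw [integral_sub i1 (hint.smul_const ξ), integral_smul_const, hφint,
      one_smul]
    rfl
  have h3 : ∀ x, ‖φ x • (π.op x ξ - ξ)‖ ≤ c⁻¹ * f x * (ε / 2) := fun x => by
    rw [norm_smul, hφ, Complex.norm_of_nonneg (mul_nonneg (inv_nonneg.2 hpos.le) (hf01 x).1)]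
    by_cases hx : x ∈ U
    · exact mul_le_mul_of_nonneg_left (le_of_lt hx)
        (mul_nonneg (inv_nonneg.2 hpos.le) (hf01 x).1)
    · rw [hf0 hx]
      simp
  have hfint : Integrable (fun x => f x) μ := f.continuous.integrable_of_hasCompactSupport hfc
  calc ‖π.integrated φ ξ - ξ‖ = ‖∫ x, φ x • (π.op x ξ - ξ) ∂μ‖ := by rw [h2]
    _ ≤ ∫ x, c⁻¹ * f x * (ε / 2) ∂μ :=
        norm_integral_le_of_norm_le ((hfint.const_mul _).mul_const _) (.of_forall h3)
    _ = ε / 2 := by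
        rw [integral_mul_const, integral_const_mul, ← hc, inv_mul_cancel₀ hpos.ne', one_mul]
    _ < ε := half_lt_self hε

theorem UnitaryRep.eq_zero_of_mul_universalRep (x : OperatorFamily.{w} G) (π : UnitaryRep.{w} G)
    (h : ∀ f : C_c(G, ℂ), (x * universalRep f) π = 0) : x π = 0 := by
  refine ContinuousLinearMap.ext fun ξ => ?_
  have hcl : ξ ∈ closure (Set.range fun f : C_c(G, ℂ) => π.integrated f ξ) := by
    rw [Metric.mem_closure_range_iff]
    intro ε hε
    obtain ⟨f, hf⟩ := π.exists_norm_integrated_sub_lt ξ hε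
    exact ⟨f, by rwa [dist_comm, dist_eq_norm]⟩
  refine closure_minimal (t := {η | x π η = 0}) ?_
    (isClosed_eq (x π).continuous continuous_const) hcl
  rintro _ ⟨f, rfl⟩
  exact congrArg (fun S : π.H →L[ℂ] π.H => S ξ) (h f)

theorem universalRep_mem_groupCStar (f : C_c(G, ℂ)) :
    (universalRep f : OperatorFamily.{w} G) ∈ groupCStar.{w} G :=
  NonUnitalStarSubalgebra.le_topologicalClosure _ (NonUnitalStarAlgebra.subset_adjoin ℂ _ ⟨f, rfl⟩)

theorem isClosed_groupCStar : IsClosed (groupCStar.{w} G : Set (OperatorFamily.{w} G)) :=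
  NonUnitalStarSubalgebra.isClosed_topologicalClosure _

/-- Products and stars are treated as operations on operators, so no convolution or involution on
`C_c(G, ℂ)` is needed. -/
theorem groupCStar_induction {p : OperatorFamily.{w} G → Prop} (hclosed : IsClosed {x | p x})
    (universal : ∀ f, p (universalRep f)) (zero : p 0) (add : ∀ x y, p x → p y → p (x + y))
    (mul : ∀ x y, p x → p y → p (x * y)) (smul : ∀ (c : ℂ) x, p x → p (c • x))
    (star : ∀ x, p x → p (star x)) {x : OperatorFamily.{w} G} (hx : x ∈ groupCStar.{w} G) :
    p x := by
  refine closure_minimal (fun y hy => ?_) hclosed hx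
  induction hy using NonUnitalStarAlgebra.adjoin_induction with
  | mem y hy => obtain ⟨f, rfl⟩ := hy; exact universal f
  | add y z _ _ hy hz => exact add y z hy hz
  | zero => exact zero
  | mul y z _ _ hy hz => exact mul y z hy hz
  | smul r y _ hy => exact smul r y hy
  | star y _ hy => exact star y hy

theorem translSpan_universalRep_le (f : C_c(G, ℂ)) {x : OperatorFamily.{w} G}
    (hx : x ∈ translSpan (universalRep f)) : x ∈ groupCStar.{w} G := by
  refine closure_minimal (t := (groupCStar.{w} G : Set (OperatorFamily.{w} G))) ?_
    isClosed_groupCStar hx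
  intro y hy
  induction hy using Submodule.span_induction with
  | mem y hy =>
    obtain ⟨g, rfl⟩ := hy
    change transl g * universalRep f ∈ groupCStar.{w} G
    rw [transl_mul_universalRep]
    exact universalRep_mem_groupCStar _
  | zero => exact (groupCStar.{w} G).zero_mem
  | add y z _ _ hy hz => exact (groupCStar.{w} G).add_mem hy hz
  | smul c y _ hy => exact (groupCStar.{w} G).smul_mem c hy

end UniversalRep

/-! ### Restriction along a continuous homomorphism -/

section Pullback

variable {G : Type u} [Group G] [TopologicalSpace G]
variable {S : Type v} [Group S] [TopologicalSpace S]

/-- The composition of a unitary representation with a continuous homomorphism. -/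
def UnitaryRep.comap (π : UnitaryRep.{w} G) (φ : S →ₜ* G) : UnitaryRep.{w} S where
  H := π.H
  op := π.op.comp φ.toMonoidHom
  continuous_op ξ := (π.continuous_op ξ).comp φ.continuous_toFun

/-- The action of families of operators for `S` on the restrictions of representations of `G`. -/
def pullback (φ : S →ₜ* G) (x : OperatorFamily.{w} S) : OperatorFamily.{w} G :=
  ⟨fun π => x (π.comap φ), memℓp_infty ⟨‖x‖, by
    rintro _ ⟨π, rfl⟩
    exact lp.norm_apply_le_norm ENNReal.top_ne_zero x (π.comap φ)⟩⟩

theorem continuous_pullback (φ : S →ₜ* G) :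
    Continuous (pullback φ : OperatorFamily.{w} S → OperatorFamily.{w} G) := by
  refine LipschitzWith.continuous (K := 1) (LipschitzWith.of_dist_le_mul fun x y => ?_)
  rw [NNReal.coe_one, one_mul, dist_eq_norm, dist_eq_norm]
  exact lp.norm_le_of_forall_le (norm_nonneg _) fun π =>
    lp.norm_apply_le_norm ENNReal.top_ne_zero (x - y) (π.comap φ)

variable [IsTopologicalGroup S] [LocallyCompactSpace S]

/-- The factor `y` makes the integrand norm continuous, so the integral exists as a Bochner integral
of operator families; the identity is then checked by applying the continuous maps `evalVec π ξ`. -/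
theorem pullback_universalRep_mul (φ : S →ₜ* G) (f : C_c(S, ℂ)) {y : OperatorFamily.{w} G}
    (hy : Continuous fun g : G => transl g * y) :
    pullback φ (universalRep f) * y
      = ∫ s, f s • (transl (φ s) * y) ∂(UnitaryRep.leftHaar S) := by
  let : MeasurableSpace S := borel S
  have : BorelSpace S := ⟨rfl⟩
  let μ : Measure S := Measure.haar
  refine OperatorFamily.ext fun π ξ => ?_
  have hint : Integrable (fun s => f s • (transl (φ s) * y)) μ :=
    (f.continuous.smul (hy.comp φ.continuous_toFun)).integrable_of_hasCompactSupport
      f.hasCompactSupport.smul_right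
  have h := (evalVec π ξ).integral_comp_comm hint
  exact h

/-- Leaving `s⁻¹` in the operator, instead of changing variables, keeps the modular function out. -/
theorem UnitaryRep.adjoint_integrated_apply (π : UnitaryRep.{w} S) (f : C_c(S, ℂ)) (ξ : π.H) :
    (π.integrated f).adjoint ξ = ∫ s, star (f s) • π.op s⁻¹ ξ ∂(UnitaryRep.leftHaar S) := by
  let : MeasurableSpace S := borel S
  have : BorelSpace S := ⟨rfl⟩
  let μ : Measure S := Measure.haar
  have hint : Integrable (fun s => star (f s) • π.op s⁻¹ ξ) μ :=
    (f.continuous.star.smul ((π.continuous_op ξ).comp continuous_inv)).integrable_of_hasCompactSupport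
      (f.hasCompactSupport.comp_left (g := star) (star_zero ℂ)).smul_right
  refine ext_inner_left ℂ fun η => ?_
  have h3 : ∫ s, inner ℂ ξ (f s • π.op s η) ∂μ = inner ℂ ξ (π.integrated f η) :=
    integral_inner (𝕜 := ℂ) (π.integrable_smul_op f η) ξ
  have h4 : ∫ s, inner ℂ η (star (f s) • π.op s⁻¹ ξ) ∂μ
      = inner ℂ η (∫ s, star (f s) • π.op s⁻¹ ξ ∂(UnitaryRep.leftHaar S)) :=
    integral_inner (𝕜 := ℂ) hint η
  rw [ContinuousLinearMap.adjoint_inner_right, ← inner_conj_symm, ← h4, ← h3, ← integral_conj]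
  refine integral_congr_ae (.of_forall fun s => ?_)
  have h5 : inner ℂ η (π.op s⁻¹ ξ) = inner ℂ (π.op s η) ξ := by
    have h6 := ContinuousLinearMap.adjoint_inner_right
      ((π.op s).toContinuousLinearEquiv : π.H →L[ℂ] π.H) η ξ
    rw [π.adjoint_op s] at h6
    exact h6
  change starRingEnd ℂ (inner ℂ ξ (f s • π.op s η)) = inner ℂ η (star (f s) • π.op s⁻¹ ξ)
  rw [inner_conj_symm, inner_smul_left, inner_smul_right, h5]
  rfl

variable [IsTopologicalGroup G]

theorem star_pullback_universalRep_mul (φ : S →ₜ* G) (f : C_c(S, ℂ)) {y : OperatorFamily.{w} G}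
    (hy : Continuous fun g : G => transl g * y) :
    star (pullback φ (universalRep f)) * y
      = ∫ s, star (f s) • (transl (φ s)⁻¹ * y) ∂(UnitaryRep.leftHaar S) := by
  let : MeasurableSpace S := borel S
  have : BorelSpace S := ⟨rfl⟩
  let μ : Measure S := Measure.haar
  refine OperatorFamily.ext fun π ξ => ?_
  have hint : Integrable (fun s => star (f s) • (transl (φ s)⁻¹ * y)) μ :=
    (f.continuous.star.smul (hy.comp φ.continuous_toFun.inv)).integrable_of_hasCompactSupport
      (f.hasCompactSupport.comp_left (g := star) (star_zero ℂ)).smul_right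
  have h1 : ∫ s, star (f s) • (π.comap φ).op s⁻¹ (y π ξ) ∂(UnitaryRep.leftHaar S)
      = evalVec π ξ (∫ s, star (f s) • (transl (φ s)⁻¹ * y) ∂μ) := by
    rw [← (evalVec π ξ).integral_comp_comm hint]
    refine integral_congr_ae (.of_forall fun s => ?_)
    change star (f s) • π.op (φ s⁻¹) (y π ξ) = star (f s) • π.op (φ s)⁻¹ (y π ξ)
    rw [map_inv]
  exact ((π.comap φ).adjoint_integrated_apply f (y π ξ)).trans h1

theorem mul_mem_translSpan {T y : OperatorFamily.{w} G}
    (h : ∀ g : G, T * (transl g * y) ∈ translSpan y) {z : OperatorFamily.{w} G}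
    (hz : z ∈ translSpan y) : T * z ∈ translSpan y := by
  refine closure_minimal (t := {z | T * z ∈ translSpan y}) ?_
    ((isClosed_translSpan y).preimage (continuous_const_mul T)) hz
  intro z hz
  induction hz using Submodule.span_induction with
  | mem z hz =>
    obtain ⟨g, rfl⟩ := hz
    exact h g
  | zero =>
    change T * 0 ∈ translSpan y
    rw [mul_zero]
    exact (translSpan y).zero_mem
  | add a b _ _ ha hb =>
    change T * (a + b) ∈ translSpan y
    rw [mul_add]
    exact (translSpan y).add_mem ha hb
  | smul c a _ ha =>
    change T * (c • a) ∈ translSpan y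
    rw [mul_smul_comm]
    exact (translSpan y).smul_mem c ha

/-- The restriction of an element of `C⋆(S)` preserves the closed span of the translates of a
family of operators that is translated continuously. -/
theorem pullback_mul_mem_translSpan (φ : S →ₜ* G) {y : OperatorFamily.{w} G}
    (hy : Continuous fun g : G => transl g * y) {x : OperatorFamily.{w} S}
    (hx : x ∈ groupCStar.{w} S) {z : OperatorFamily.{w} G} (hz : z ∈ translSpan y) :
    pullback φ x * z ∈ translSpan y := by
  have hy' : ∀ g : G, Continuous fun g' : G => transl g' * (transl g * y) := fun g => by
    have : (fun g' : G => transl g' * (transl g * y)) = fun g' => transl (g' * g) * y :=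
      funext fun g' => by rw [transl_mul, mul_assoc]
    rw [this]
    exact hy.comp (continuous_mul_const g)
  have hmem : ∀ g' g : G, transl g' * (transl g * y) ∈ translSpan y := fun g' g => by
    rw [← mul_assoc, ← transl_mul]
    exact transl_mul_mem_translSpan y _
  -- Both `x` and `star x` are carried through the induction, because the star case exchanges the
  -- two claims.
  have key : ∀ z ∈ translSpan y, pullback φ x * z ∈ translSpan y ∧
      star (pullback φ x) * z ∈ translSpan y := by
    refine groupCStar_induction (p := fun x => ∀ z ∈ translSpan y,
      pullback φ x * z ∈ translSpan y ∧ star (pullback φ x) * z ∈ translSpan y)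
      ?_ ?_ ?_ ?_ ?_ ?_ ?_ hx
    · simp only [Set.ofPred_forall, Set.ofPred_and]
      refine isClosed_iInter fun z => isClosed_iInter fun _ => IsClosed.inter ?_ ?_
      · exact (isClosed_translSpan y).preimage
          ((continuous_mul_const z).comp (continuous_pullback φ))
      · exact (isClosed_translSpan y).preimage
          ((continuous_mul_const z).comp (continuous_star.comp (continuous_pullback φ)))
    · intro f z hz
      let : MeasurableSpace S := borel S
      have : BorelSpace S := ⟨rfl⟩
      refine ⟨mul_mem_translSpan (fun g => ?_) hz, mul_mem_translSpan (fun g => ?_) hz⟩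
      · rw [pullback_universalRep_mul φ f (hy' g)]
        refine integral_smul_mem _ (isClosed_translSpan y) ?_
          fun s => (translSpan y).smul_mem _ (hmem _ g)
        exact (f.continuous.smul ((hy' g).comp φ.continuous_toFun)).integrable_of_hasCompactSupport
          f.hasCompactSupport.smul_right (μ := (Measure.haar : Measure S))
      · rw [star_pullback_universalRep_mul φ f (hy' g)]
        refine integral_smul_mem _ (isClosed_translSpan y) ?_
          fun s => (translSpan y).smul_mem _ (hmem _ g)
        exact (f.continuous.star.smul
          ((hy' g).comp φ.continuous_toFun.inv)).integrable_of_hasCompactSupport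
          (f.hasCompactSupport.comp_left (g := star) (star_zero ℂ)).smul_right
          (μ := (Measure.haar : Measure S))
    · intro z _
      have h0 : pullback φ (0 : OperatorFamily.{w} S) = 0 := rfl
      rw [h0, star_zero, zero_mul]
      exact ⟨(translSpan y).zero_mem, (translSpan y).zero_mem⟩
    · intro a b ha hb z hz
      have h0 : pullback φ (a + b) = pullback φ a + pullback φ b := rfl
      rw [h0, star_add, add_mul, add_mul]
      exact ⟨(translSpan y).add_mem (ha z hz).1 (hb z hz).1,
        (translSpan y).add_mem (ha z hz).2 (hb z hz).2⟩
    · intro a b ha hb z hz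
      have h0 : pullback φ (a * b) = pullback φ a * pullback φ b := rfl
      rw [h0, star_mul, mul_assoc, mul_assoc]
      exact ⟨(ha _ (hb z hz).1).1, (hb _ (ha z hz).2).2⟩
    · intro c a ha z hz
      have h0 : pullback φ (c • a) = c • pullback φ a := rfl
      rw [h0, star_smul, smul_mul_assoc, smul_mul_assoc]
      exact ⟨(translSpan y).smul_mem _ (ha z hz).1, (translSpan y).smul_mem _ (ha z hz).2⟩
    · intro a ha z hz
      have h0 : pullback φ (star a) = star (pullback φ a) := rfl
      rw [h0, star_star]
      exact (ha z hz).symm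
  exact (key z hz).1

theorem mul_mem_translSpan_of_mem_groupCStar [LocallyCompactSpace G] {y : OperatorFamily.{w} G}
    (hy : Continuous fun g : G => transl g * y) {x : OperatorFamily.{w} G}
    (hx : x ∈ groupCStar.{w} G) {z : OperatorFamily.{w} G} (hz : z ∈ translSpan y) :
    x * z ∈ translSpan y :=
  pullback_mul_mem_translSpan (ContinuousMonoidHom.id G) hy hx hz

end Pullback

/-! ### Open subsets of the dual -/

section Dual

variable {G : Type u} [Group G] [TopologicalSpace G] [IsTopologicalGroup G]
  [LocallyCompactSpace G]

theorem mul_universalRep_mem_groupCStar {x : OperatorFamily.{w} G} (hx : x ∈ groupCStar.{w} G)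
    (f : C_c(G, ℂ)) : x * universalRep f ∈ groupCStar.{w} G :=
  (groupCStar.{w} G).mul_mem hx (universalRep_mem_groupCStar f)

theorem UnitaryDual.mem_ker_mk {π : UnitaryRep.{w} G} (hπ : π.IsIrreducible)
    (x : groupCStar.{w} G) :
    x ∈ (UnitaryDual.mk π hπ).ker ↔ (x : OperatorFamily.{w} G) π = 0 := Iff.rfl

/-- Left multipliers of the image of the compactly supported functions define open sets. -/
theorem UnitaryDual.exists_isOpen_of_multiplier {T : OperatorFamily.{w} G}
    (hT : ∀ f : C_c(G, ℂ), T * universalRep f ∈ groupCStar.{w} G) :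
    ∃ U : Set (UnitaryDual.{w} G), IsOpen U ∧
      ∀ (π : UnitaryRep.{w} G) (hπ : π.IsIrreducible), UnitaryDual.mk π hπ ∈ U ↔ T π ≠ 0 := by
  -- `T` need not lie in `C⋆(G)`, but the products with `universalRep f` do, and by nondegeneracy
  -- they jointly detect `T π ≠ 0`.
  refine ⟨⋃ f : C_c(G, ℂ), {z | (⟨T * universalRep f, hT f⟩ : groupCStar.{w} G) ∉ z.ker},
    isOpen_iUnion fun f => TopologicalSpace.isOpen_generateFrom_of_mem ⟨_, rfl⟩, ?_⟩
  intro π hπ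
  rw [Set.mem_iUnion]
  constructor
  · rintro ⟨f, hf⟩ h0
    refine hf ((UnitaryDual.mem_ker_mk hπ _).2 ?_)
    change T π * universalRep f π = 0
    rw [h0, zero_mul]
  · intro hne
    by_contra! hcon
    refine hne (UnitaryRep.eq_zero_of_mul_universalRep T π fun f => ?_)
    exact (UnitaryDual.mem_ker_mk hπ _).1 (not_not.1 (hcon f))

end Dual

/-! ### Intertwining operators -/

section Intertwiner

variable {G : Type u} [Group G] [TopologicalSpace G]

theorem UnitaryRep.inner_op_inv (π : UnitaryRep.{w} G) (g : G) (ξ η : π.H) :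
    inner ℂ (π.op g⁻¹ ξ) η = inner ℂ ξ (π.op g η) := by
  have h := ContinuousLinearMap.adjoint_inner_left
    ((π.op g).toContinuousLinearEquiv : π.H →L[ℂ] π.H) η ξ
  rw [π.adjoint_op g] at h
  exact h

theorem UnitaryRep.adjoint_intertwine {π σ : UnitaryRep.{w} G} {T : π.H →L[ℂ] σ.H}
    (hT : ∀ (g : G) (ξ : π.H), T (π.op g ξ) = σ.op g (T ξ)) (g : G) (η : σ.H) :
    T.adjoint (σ.op g η) = π.op g (T.adjoint η) := by
  refine ext_inner_left ℂ fun ξ => ?_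
  rw [ContinuousLinearMap.adjoint_inner_right, ← UnitaryRep.inner_op_inv, ← hT,
    ← ContinuousLinearMap.adjoint_inner_right, UnitaryRep.inner_op_inv]

variable [IsTopologicalGroup G] [LocallyCompactSpace G]

theorem UnitaryRep.integrated_intertwine_of_bounded {π σ : UnitaryRep.{w} G} {T : π.H →L[ℂ] σ.H}
    (hT : ∀ (g : G) (ξ : π.H), T (π.op g ξ) = σ.op g (T ξ)) (f : C_c(G, ℂ)) (ξ : π.H) :
    T (π.integrated f ξ) = σ.integrated f (T ξ) := by
  let : MeasurableSpace G := borel G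
  rw [UnitaryRep.integrated_apply, UnitaryRep.integrated_apply,
    ← T.integral_comp_comm (π.integrable_smul_op f ξ)]
  simp [hT]

/-- Bounded intertwining operators intertwine the actions of `C⋆(G)`. -/
theorem UnitaryRep.groupCStar_intertwine {π σ : UnitaryRep.{w} G} {T : π.H →L[ℂ] σ.H}
    (hT : ∀ (g : G) (ξ : π.H), T (π.op g ξ) = σ.op g (T ξ)) {x : OperatorFamily.{w} G}
    (hx : x ∈ groupCStar.{w} G) : T ∘L x π = x σ ∘L T := by
  -- The relation for `T.adjoint` is included because taking adjoints in the star case turns each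
  -- relation into the other.
  have key : T ∘L x π = x σ ∘L T ∧ T.adjoint ∘L x σ = x π ∘L T.adjoint := by
    refine groupCStar_induction (p := fun x => T ∘L x π = x σ ∘L T ∧
      T.adjoint ∘L x σ = x π ∘L T.adjoint) ?_ ?_ ?_ ?_ ?_ ?_ ?_ hx
    · exact (isClosed_eq (continuous_const.clm_comp (continuous_eval π))
        ((continuous_eval σ).clm_comp continuous_const)).inter
        (isClosed_eq (continuous_const.clm_comp (continuous_eval σ))
        ((continuous_eval π).clm_comp continuous_const))
    · intro f
      exact ⟨ContinuousLinearMap.ext fun ξ => UnitaryRep.integrated_intertwine_of_bounded hT f ξ,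
        ContinuousLinearMap.ext fun ξ =>
          UnitaryRep.integrated_intertwine_of_bounded (UnitaryRep.adjoint_intertwine hT) f ξ⟩
    · change T ∘L 0 = 0 ∘L T ∧ T.adjoint ∘L 0 = 0 ∘L T.adjoint
      simp
    · intro a b ha hb
      change T ∘L (a π + b π) = (a σ + b σ) ∘L T ∧
        T.adjoint ∘L (a σ + b σ) = (a π + b π) ∘L T.adjoint
      rw [ContinuousLinearMap.comp_add, ContinuousLinearMap.add_comp, ContinuousLinearMap.comp_add,
        ContinuousLinearMap.add_comp, ha.1, ha.2, hb.1, hb.2]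
      exact ⟨rfl, rfl⟩
    · intro a b ha hb
      change T ∘L (a π ∘L b π) = (a σ ∘L b σ) ∘L T ∧
        T.adjoint ∘L (a σ ∘L b σ) = (a π ∘L b π) ∘L T.adjoint
      rw [← ContinuousLinearMap.comp_assoc, ha.1, ContinuousLinearMap.comp_assoc, hb.1,
        ← ContinuousLinearMap.comp_assoc T.adjoint, ha.2, ContinuousLinearMap.comp_assoc _ _ (b σ),
        hb.2]
      exact ⟨rfl, rfl⟩
    · intro c a ha
      change T ∘L (c • a π) = (c • a σ) ∘L T ∧ T.adjoint ∘L (c • a σ) = (c • a π) ∘L T.adjoint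
      rw [ContinuousLinearMap.comp_smul, ContinuousLinearMap.smul_comp,
        ContinuousLinearMap.comp_smul, ContinuousLinearMap.smul_comp, ha.1, ha.2]
      exact ⟨rfl, rfl⟩
    · intro a ha
      change T ∘L (a π).adjoint = (a σ).adjoint ∘L T ∧
        T.adjoint ∘L (a σ).adjoint = (a π).adjoint ∘L T.adjoint
      have h1 := congrArg ContinuousLinearMap.adjoint ha.1
      have h2 := congrArg ContinuousLinearMap.adjoint ha.2
      rw [ContinuousLinearMap.adjoint_comp, ContinuousLinearMap.adjoint_comp] at h1 h2
      rw [ContinuousLinearMap.adjoint_adjoint] at h2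
      exact ⟨h2.symm, h1.symm⟩
  exact key.1

end Intertwiner

/-! ### Irreducible representations -/

section Irreducible

variable {G : Type u} [Group G] [TopologicalSpace G]

/-- The operators of a unitary representation. -/
def UnitaryRep.opSet (π : UnitaryRep.{w} G) : Set (π.H →L[ℂ] π.H) :=
  Set.range fun g : G => ((π.op g).toContinuousLinearEquiv : π.H →L[ℂ] π.H)

theorem UnitaryRep.IsIrreducible.isIrreducibleSet {π : UnitaryRep.{w} G} (h : π.IsIrreducible) :
    IsIrreducibleSet π.opSet := fun K hK hinv =>
  h.2 K hK fun g ξ hξ => hinv _ ⟨g, rfl⟩ ξ hξ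

/-- Schur's lemma for irreducible unitary representations. -/
theorem UnitaryRep.IsIrreducible.exists_eq_smul {π : UnitaryRep.{w} G} (h : π.IsIrreducible)
    {T : π.H →L[ℂ] π.H} (hT : ∀ (g : G) (ξ : π.H), T (π.op g ξ) = π.op g (T ξ)) :
    ∃ c : ℂ, T = c • 1 := by
  refine h.isIrreducibleSet.exists_eq_smul ?_ ?_
  · rintro _ ⟨g, rfl⟩
    exact ⟨g⁻¹, (π.adjoint_op g).symm⟩
  · rintro _ ⟨g, rfl⟩
    exact ContinuousLinearMap.ext fun ξ => hT g ξ

/-- Converse of Schur's lemma. -/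
theorem UnitaryRep.isIrreducible_of_forall_eq_smul {π : UnitaryRep.{w} G} (hn : Nontrivial π.H)
    (h : ∀ T : π.H →L[ℂ] π.H, (∀ (g : G) (ξ : π.H), T (π.op g ξ) = π.op g (T ξ)) →
      ∃ c : ℂ, T = c • 1) : π.IsIrreducible := by
  refine ⟨hn, fun K hK hinv => ?_⟩
  have := hK.completeSpace_coe
  -- The projection intertwines: `π.op g` maps `K` into itself, and, by invariance under `g⁻¹`, also
  -- its orthogonal complement.
  obtain ⟨c, hc⟩ := h K.starProjection fun g ξ => by
    refine Submodule.eq_starProjection_of_mem_of_inner_eq_zero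
      (hinv g _ (Submodule.starProjection_apply_mem K ξ)) fun k hk => ?_
    rw [← map_sub, ← inner_conj_symm, ← UnitaryRep.inner_op_inv,
      Submodule.inner_right_of_mem_orthogonal (hinv _ _ hk)
        (Submodule.sub_starProjection_mem_orthogonal ξ), map_zero]
  rw [or_iff_not_imp_left, Submodule.eq_bot_iff]
  intro hne
  push Not at hne
  obtain ⟨k, hk, hk0⟩ := hne
  have h1 : c • k = (1 : ℂ) • k := by
    have h2 := Submodule.starProjection_eq_self_iff.2 hk
    rw [hc] at h2
    simpa using h2
  have hc1 : c = 1 := smul_left_injective ℂ hk0 h1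
  rw [Submodule.eq_top_iff']
  intro x
  rw [← Submodule.starProjection_eq_self_iff, hc, hc1]
  simp

end Irreducible

/-! ### Tensor products of representations -/

section HilbertTensor

variable {E F : Type*} [NormedAddCommGroup E] [InnerProductSpace ℂ E]
  [NormedAddCommGroup F] [InnerProductSpace ℂ F]

/-- The elementary tensor in the Hilbert space tensor product. -/
def htmul (ξ : E) (η : F) : UniformSpace.Completion (E ⊗[ℂ] F) := ((ξ ⊗ₜ[ℂ] η : E ⊗[ℂ] F) :)

theorem inner_htmul (ξ ξ' : E) (η η' : F) :
    inner ℂ (htmul ξ η) (htmul ξ' η') = inner ℂ ξ ξ' * inner ℂ η η' := by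
  rw [htmul, htmul, UniformSpace.Completion.inner_coe, TensorProduct.inner_tmul]

theorem norm_htmul (ξ : E) (η : F) : ‖htmul ξ η‖ = ‖ξ‖ * ‖η‖ := by
  rw [htmul, UniformSpace.Completion.norm_coe, TensorProduct.norm_tmul]

/-- The operator `ξ ↦ ξ ⊗ η`. -/
def htmulRight (η : F) : E →L[ℂ] UniformSpace.Completion (E ⊗[ℂ] F) :=
  LinearMap.mkContinuous
    { toFun := fun ξ => htmul ξ η
      map_add' := fun ξ ξ' => by
        rw [htmul, TensorProduct.add_tmul, UniformSpace.Completion.coe_add]; rfl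
      map_smul' := fun c ξ => by
        rw [htmul, ← TensorProduct.smul_tmul', UniformSpace.Completion.coe_smul]; rfl } ‖η‖
    fun ξ => ((norm_htmul ξ η).trans (mul_comm _ _)).le

/-- The operator `η ↦ ξ ⊗ η`. -/
def htmulLeft (ξ : E) : F →L[ℂ] UniformSpace.Completion (E ⊗[ℂ] F) :=
  LinearMap.mkContinuous
    { toFun := fun η => htmul ξ η
      map_add' := fun η η' => by
        rw [htmul, TensorProduct.tmul_add, UniformSpace.Completion.coe_add]; rfl
      map_smul' := fun c η => by simp [htmul] } ‖ξ‖
    fun η => (norm_htmul ξ η).le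

theorem htmul_hom_ext {L : Type*} [NormedAddCommGroup L] [NormedSpace ℂ L]
    {S T : UniformSpace.Completion (E ⊗[ℂ] F) →L[ℂ] L}
    (h : ∀ (ξ : E) (η : F), S (htmul ξ η) = T (htmul ξ η)) : S = T := by
  ext x
  induction x using UniformSpace.Completion.induction_on with
  | hp => exact isClosed_eq S.continuous T.continuous
  | ih a =>
    induction a using TensorProduct.induction_on with
    | zero => rw [UniformSpace.Completion.coe_zero, map_zero, map_zero]
    | tmul ξ η => exact h ξ η
    | add a b ha hb => rw [UniformSpace.Completion.coe_add, map_add, map_add, ha, hb]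

theorem htmul_inner_ext {x y : UniformSpace.Completion (E ⊗[ℂ] F)}
    (h : ∀ (ξ : E) (η : F), inner ℂ (htmul ξ η) x = inner ℂ (htmul ξ η) y) : x = y := by
  have h1 : innerSL ℂ x = innerSL ℂ y := htmul_hom_ext fun ξ η => by
    rw [innerSL_apply_apply, innerSL_apply_apply, ← inner_conj_symm, h, inner_conj_symm]
  refine ext_inner_right ℂ fun z => ?_
  exact congrArg (fun S : UniformSpace.Completion (E ⊗[ℂ] F) →L[ℂ] ℂ => S z) h1

/-- A bounded operator all of whose slices are scalar is scalar. -/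
theorem eq_smul_of_slices [Nontrivial E]
    {T : UniformSpace.Completion (E ⊗[ℂ] F) →L[ℂ] UniformSpace.Completion (E ⊗[ℂ] F)}
    (h₁ : ∀ η η' : F, ∃ c : ℂ, ∀ ξ ξ' : E,
      inner ℂ (htmul ξ' η') (T (htmul ξ η)) = c * inner ℂ ξ' ξ)
    (h₂ : ∀ ξ ξ' : E, ∃ c : ℂ, ∀ η η' : F,
      inner ℂ (htmul ξ' η') (T (htmul ξ η)) = c * inner ℂ η' η) :
    ∃ c : ℂ, T = c • 1 := by
  obtain ⟨ξ₀, hξ₀⟩ := exists_norm_eq E zero_le_one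
  have h0 : inner ℂ ξ₀ ξ₀ = (1 : ℂ) := by simp [inner_self_eq_norm_sq_to_K, hξ₀]
  obtain ⟨c, hc⟩ := h₂ ξ₀ ξ₀
  refine ⟨c, htmul_hom_ext fun ξ η => htmul_inner_ext fun ξ' η' => ?_⟩
  obtain ⟨d, hd⟩ := h₁ η η'
  -- Both slice formulas are evaluated at the unit vector `ξ₀`.
  have h3 : d = c * inner ℂ η' η := by
    have h4 := hd ξ₀ ξ₀
    rw [h0, mul_one, hc] at h4
    exact h4.symm
  have h5 : (c • (1 : UniformSpace.Completion (E ⊗[ℂ] F) →L[ℂ] _)) (htmul ξ η)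
      = c • htmul ξ η := rfl
  rw [hd, h3, h5, inner_smul_right, inner_htmul]
  ring

theorem completionIsometryEquiv_htmul {E' F' : Type*} [NormedAddCommGroup E']
    [InnerProductSpace ℂ E'] [NormedAddCommGroup F'] [InnerProductSpace ℂ F'] (U : E ≃ₗᵢ[ℂ] E')
    (V : F ≃ₗᵢ[ℂ] F') (ξ : E) (η : F) :
    UnitaryRep.completionIsometryEquiv (TensorProduct.congrIsometry U V) (htmul ξ η)
      = htmul (U ξ) (V η) := by
  simp [htmul]

end HilbertTensor

/-! ### Exterior tensor products: irreducibility, equivalence and the action of the factor algebras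
-/

section Tensor

variable {G₁ : Type u} [Group G₁] [TopologicalSpace G₁]
variable {G₂ : Type v} [Group G₂] [TopologicalSpace G₂]

/-- The elementary tensor in the space of `π₁ ⊗ π₂`. -/
def UnitaryRep.tmul (π₁ : UnitaryRep.{w} G₁) (π₂ : UnitaryRep.{w} G₂) (ξ : π₁.H) (η : π₂.H) :
    (π₁.tensor π₂).H := htmul ξ η

/-- The operator `ξ ↦ ξ ⊗ η`. -/
def UnitaryRep.tmulRight (π₁ : UnitaryRep.{w} G₁) (π₂ : UnitaryRep.{w} G₂) (η : π₂.H) :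
    π₁.H →L[ℂ] (π₁.tensor π₂).H := htmulRight η

/-- The operator `η ↦ ξ ⊗ η`. -/
def UnitaryRep.tmulLeft (π₁ : UnitaryRep.{w} G₁) (π₂ : UnitaryRep.{w} G₂) (ξ : π₁.H) :
    π₂.H →L[ℂ] (π₁.tensor π₂).H := htmulLeft ξ

namespace UnitaryRep

variable (π₁ : UnitaryRep.{w} G₁) (π₂ : UnitaryRep.{w} G₂)

theorem tmulRight_apply (ξ : π₁.H) (η : π₂.H) : tmulRight π₁ π₂ η ξ = tmul π₁ π₂ ξ η := rfl

theorem tmulLeft_apply (ξ : π₁.H) (η : π₂.H) : tmulLeft π₁ π₂ ξ η = tmul π₁ π₂ ξ η := rfl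

theorem inner_tmul (ξ ξ' : π₁.H) (η η' : π₂.H) :
    inner ℂ (tmul π₁ π₂ ξ η) (tmul π₁ π₂ ξ' η') = inner ℂ ξ ξ' * inner ℂ η η' :=
  inner_htmul ξ ξ' η η'

theorem norm_tmul (ξ : π₁.H) (η : π₂.H) : ‖tmul π₁ π₂ ξ η‖ = ‖ξ‖ * ‖η‖ := norm_htmul ξ η

variable {π₁ π₂} in
theorem tmul_hom_ext {L : Type*} [NormedAddCommGroup L] [NormedSpace ℂ L]
    {S T : (π₁.tensor π₂).H →L[ℂ] L}
    (h : ∀ (ξ : π₁.H) (η : π₂.H), S (tmul π₁ π₂ ξ η) = T (tmul π₁ π₂ ξ η)) : S = T :=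
  htmul_hom_ext (E := π₁.H) (F := π₂.H) h

variable {π₁ π₂} in
theorem eq_smul_of_tmul_slices [Nontrivial π₁.H]
    {T : (π₁.tensor π₂).H →L[ℂ] (π₁.tensor π₂).H}
    (h₁ : ∀ η η' : π₂.H, ∃ c : ℂ, ∀ ξ ξ' : π₁.H,
      inner ℂ (tmul π₁ π₂ ξ' η') (T (tmul π₁ π₂ ξ η)) = c * inner ℂ ξ' ξ)
    (h₂ : ∀ ξ ξ' : π₁.H, ∃ c : ℂ, ∀ η η' : π₂.H,
      inner ℂ (tmul π₁ π₂ ξ' η') (T (tmul π₁ π₂ ξ η)) = c * inner ℂ η' η) :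
    ∃ c : ℂ, T = c • 1 :=
  eq_smul_of_slices (E := π₁.H) (F := π₂.H) (T := T) h₁ h₂

theorem tensor_op_tmul (g : G₁ × G₂) (ξ : π₁.H) (η : π₂.H) :
    (π₁.tensor π₂).op g (tmul π₁ π₂ ξ η) = tmul π₁ π₂ (π₁.op g.1 ξ) (π₂.op g.2 η) :=
  UnitaryRep.tensorOp_coe_tmul π₁ π₂ g ξ η

theorem tmulRight_intertwine (η : π₂.H) (g : G₁) (ξ : π₁.H) :
    tmulRight π₁ π₂ η (π₁.op g ξ) = (π₁.tensor π₂).op (g, 1) (tmulRight π₁ π₂ η ξ) := by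
  rw [tmulRight_apply, tmulRight_apply, tensor_op_tmul, map_one]
  rfl

theorem tmulLeft_intertwine (ξ : π₁.H) (g : G₂) (η : π₂.H) :
    tmulLeft π₁ π₂ ξ (π₂.op g η) = (π₁.tensor π₂).op (1, g) (tmulLeft π₁ π₂ ξ η) := by
  rw [tmulLeft_apply, tmulLeft_apply, tensor_op_tmul, map_one]
  rfl

/-- Compressions of intertwiners by intertwiners of an irreducible representation are scalar. -/
theorem IsIrreducible.exists_compression_eq {G : Type u} [Group G] [TopologicalSpace G]
    {π ρ : UnitaryRep.{w} G} (h : π.IsIrreducible) {V W : π.H →L[ℂ] ρ.H} {T : ρ.H →L[ℂ] ρ.H}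
    (hV : ∀ (g : G) (ξ : π.H), V (π.op g ξ) = ρ.op g (V ξ))
    (hW : ∀ (g : G) (ξ : π.H), W (π.op g ξ) = ρ.op g (W ξ))
    (hT : ∀ (g : G) (ξ : ρ.H), T (ρ.op g ξ) = ρ.op g (T ξ)) :
    ∃ c : ℂ, ∀ ξ ξ' : π.H, inner ℂ (W ξ') (T (V ξ)) = c * inner ℂ ξ' ξ := by
  obtain ⟨c, hc⟩ := h.exists_eq_smul (T := W.adjoint ∘L T ∘L V) fun g ξ => by
    change W.adjoint (T (V (π.op g ξ))) = π.op g (W.adjoint (T (V ξ)))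
    rw [hV, hT, UnitaryRep.adjoint_intertwine hW]
  refine ⟨c, fun ξ ξ' => ?_⟩
  rw [← ContinuousLinearMap.adjoint_inner_right]
  have h1 : W.adjoint (T (V ξ)) = c • ξ :=
    congrArg (fun S : π.H →L[ℂ] π.H => S ξ) hc
  rw [h1, inner_smul_right]

variable {π₁ π₂}

/-- For fixed `η`, the map `ξ ↦ ξ ⊗ η` intertwines `π₁` with the restriction to `G₁`, so Schur makes
the slices of a commuting operator scalar in the first variable. The same holds in the second, and
`eq_smul_of_tmul_slices` concludes. -/
theorem IsIrreducible.tensor (h₁ : π₁.IsIrreducible) (h₂ : π₂.IsIrreducible) :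
    (π₁.tensor π₂).IsIrreducible := by
  have := h₁.1
  have := h₂.1
  refine UnitaryRep.isIrreducible_of_forall_eq_smul ?_ fun T hT => ?_
  · obtain ⟨ξ, hξ⟩ := exists_ne (0 : π₁.H)
    obtain ⟨η, hη⟩ := exists_ne (0 : π₂.H)
    refine nontrivial_of_ne (tmul π₁ π₂ ξ η) 0 ?_
    rw [← norm_ne_zero_iff, norm_tmul]
    exact mul_ne_zero (norm_ne_zero_iff.2 hξ) (norm_ne_zero_iff.2 hη)
  · refine eq_smul_of_tmul_slices (fun η η' => ?_) (fun ξ ξ' => ?_)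
    · exact h₁.exists_compression_eq (ρ := (π₁.tensor π₂).comap (ContinuousMonoidHom.inl G₁ G₂))
        (T := T) (V := tmulRight π₁ π₂ η) (W := tmulRight π₁ π₂ η')
        (tmulRight_intertwine π₁ π₂ η) (tmulRight_intertwine π₁ π₂ η')
        fun g x => hT (g, 1) x
    · exact h₂.exists_compression_eq (ρ := (π₁.tensor π₂).comap (ContinuousMonoidHom.inr G₁ G₂))
        (T := T) (V := tmulLeft π₁ π₂ ξ) (W := tmulLeft π₁ π₂ ξ')
        (tmulLeft_intertwine π₁ π₂ ξ) (tmulLeft_intertwine π₁ π₂ ξ')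
        fun g x => hT (1, g) x

theorem Equivalent.tensor {σ₁ : UnitaryRep.{w} G₁} {σ₂ : UnitaryRep.{w} G₂}
    (h₁ : π₁.Equivalent σ₁) (h₂ : π₂.Equivalent σ₂) :
    (π₁.tensor π₂).Equivalent (σ₁.tensor σ₂) := by
  obtain ⟨U, hU⟩ := h₁
  obtain ⟨V, hV⟩ := h₂
  let Φ : (π₁.tensor π₂).H ≃ₗᵢ[ℂ] (σ₁.tensor σ₂).H :=
    completionIsometryEquiv (TensorProduct.congrIsometry U V)
  have hΦ : ∀ (ξ : π₁.H) (η : π₂.H), Φ (tmul π₁ π₂ ξ η) = tmul σ₁ σ₂ (U ξ) (V η) :=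
    completionIsometryEquiv_htmul U V
  refine ⟨Φ, fun g x => ?_⟩
  have h : (Φ.toContinuousLinearEquiv : (π₁.tensor π₂).H →L[ℂ] (σ₁.tensor σ₂).H) ∘L
      (((π₁.tensor π₂).op g).toContinuousLinearEquiv : (π₁.tensor π₂).H →L[ℂ] (π₁.tensor π₂).H)
      = (((σ₁.tensor σ₂).op g).toContinuousLinearEquiv :
          (σ₁.tensor σ₂).H →L[ℂ] (σ₁.tensor σ₂).H) ∘L
        (Φ.toContinuousLinearEquiv : (π₁.tensor π₂).H →L[ℂ] (σ₁.tensor σ₂).H) := by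
    refine tmul_hom_ext fun ξ η => ?_
    change Φ ((π₁.tensor π₂).op g (tmul π₁ π₂ ξ η)) = (σ₁.tensor σ₂).op g (Φ (tmul π₁ π₂ ξ η))
    rw [tensor_op_tmul, hΦ, hΦ, tensor_op_tmul, hU, hV]
  exact congrArg (fun S : (π₁.tensor π₂).H →L[ℂ] (σ₁.tensor σ₂).H => S x) h

variable (π₁ π₂)
variable [IsTopologicalGroup G₁] [LocallyCompactSpace G₁]
variable [IsTopologicalGroup G₂] [LocallyCompactSpace G₂]

theorem pullback_inl_tmul {x : OperatorFamily.{w} G₁} (hx : x ∈ groupCStar.{w} G₁)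
    (ξ : π₁.H) (η : π₂.H) :
    pullback (ContinuousMonoidHom.inl G₁ G₂) x (π₁.tensor π₂) (tmul π₁ π₂ ξ η)
      = tmul π₁ π₂ (x π₁ ξ) η := by
  have h := groupCStar_intertwine (π := π₁)
    (σ := (π₁.tensor π₂).comap (ContinuousMonoidHom.inl G₁ G₂)) (T := tmulRight π₁ π₂ η)
    (tmulRight_intertwine π₁ π₂ η) hx
  exact (congrArg (fun S : π₁.H →L[ℂ] (π₁.tensor π₂).H => S ξ) h).symm

theorem pullback_inr_tmul {x : OperatorFamily.{w} G₂} (hx : x ∈ groupCStar.{w} G₂)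
    (ξ : π₁.H) (η : π₂.H) :
    pullback (ContinuousMonoidHom.inr G₁ G₂) x (π₁.tensor π₂) (tmul π₁ π₂ ξ η)
      = tmul π₁ π₂ ξ (x π₂ η) := by
  have h := groupCStar_intertwine (π := π₂)
    (σ := (π₁.tensor π₂).comap (ContinuousMonoidHom.inr G₁ G₂)) (T := tmulLeft π₁ π₂ ξ)
    (tmulLeft_intertwine π₁ π₂ ξ) hx
  exact (congrArg (fun S : π₂.H →L[ℂ] (π₁.tensor π₂).H => S η) h).symm

/-- The restricted element acts as `x ⊗ 1`. Hence the kernel of `π₁` can be read off from `π₁ ⊗ π₂`,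
which is what relative openness needs. -/
theorem pullback_inl_tensor_eq_zero_iff {x : OperatorFamily.{w} G₁} (hx : x ∈ groupCStar.{w} G₁)
    [Nontrivial π₂.H] :
    pullback (ContinuousMonoidHom.inl G₁ G₂) x (π₁.tensor π₂) = 0 ↔ x π₁ = 0 := by
  constructor
  · intro h
    obtain ⟨η, hη⟩ := exists_ne (0 : π₂.H)
    refine ContinuousLinearMap.ext fun ξ => ?_
    have h1 := pullback_inl_tmul π₁ π₂ hx ξ η
    have h2 : ‖x π₁ ξ‖ * ‖η‖ = 0 := by
      rw [← norm_tmul, ← h1, h]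
      exact norm_zero
    exact norm_eq_zero.1 ((mul_eq_zero.1 h2).resolve_right (norm_ne_zero_iff.2 hη))
  · intro h
    refine tmul_hom_ext fun ξ η => (pullback_inl_tmul π₁ π₂ hx ξ η).trans ?_
    rw [h]
    exact map_zero (tmulRight π₁ π₂ η)

theorem pullback_inr_tensor_eq_zero_iff {x : OperatorFamily.{w} G₂} (hx : x ∈ groupCStar.{w} G₂)
    [Nontrivial π₁.H] :
    pullback (ContinuousMonoidHom.inr G₁ G₂) x (π₁.tensor π₂) = 0 ↔ x π₂ = 0 := by
  constructor
  · intro h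
    obtain ⟨ξ, hξ⟩ := exists_ne (0 : π₁.H)
    refine ContinuousLinearMap.ext fun η => ?_
    have h1 := pullback_inr_tmul π₁ π₂ hx ξ η
    have h2 : ‖ξ‖ * ‖x π₂ η‖ = 0 := by
      rw [← norm_tmul, ← h1, h]
      exact norm_zero
    exact norm_eq_zero.1 ((mul_eq_zero.1 h2).resolve_left (norm_ne_zero_iff.2 hξ))
  · intro h
    refine tmul_hom_ext fun ξ η => (pullback_inr_tmul π₁ π₂ hx ξ η).trans ?_
    rw [h]
    exact map_zero (tmulLeft π₁ π₂ ξ)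

end UnitaryRep

end Tensor

/-! ### Vector states of irreducible representations vary continuously -/

section VectorStates

variable {G : Type u} [Group G] [TopologicalSpace G] [IsTopologicalGroup G]
  [LocallyCompactSpace G]

instance : IsClosed (groupCStar.{w} G : Set (OperatorFamily.{w} G)) := isClosed_groupCStar

instance : NonUnitalCStarAlgebra (groupCStar.{w} G) :=
  NonUnitalStarSubalgebra.nonUnitalCStarAlgebra _

/-- The representation of `C⋆(G)` defined by a unitary representation of `G`. -/
def UnitaryRep.onCStarHom (π : UnitaryRep.{w} G) : groupCStar.{w} G →⋆ₙₐ[ℂ] (π.H →L[ℂ] π.H) where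
  toFun x := (x : OperatorFamily.{w} G) π
  map_smul' _ _ := rfl
  map_zero' := rfl
  map_add' _ _ := rfl
  map_mul' _ _ := rfl
  map_star' _ := rfl

/-- The representation of the unitization of `C⋆(G)` defined by a unitary representation of `G`. -/
def UnitaryRep.onUnitization (π : UnitaryRep.{w} G) :
    Unitization ℂ (groupCStar.{w} G) →⋆ₐ[ℂ] (π.H →L[ℂ] π.H) :=
  Unitization.starLift π.onCStarHom

theorem UnitaryRep.onUnitization_inr (π : UnitaryRep.{w} G) (x : groupCStar.{w} G) :
    π.onUnitization (x : Unitization ℂ (groupCStar.{w} G)) = (x : OperatorFamily.{w} G) π := by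
  have h := Unitization.starLift_symm_apply_apply π.onUnitization x
  rw [← h, UnitaryRep.onUnitization, Equiv.symm_apply_apply]
  rfl

/-- The unitization supplies the unit that the state arguments need. Its elements act as left
multipliers, so they still define open subsets of the dual. -/
theorem UnitaryRep.onUnitization_apply (π : UnitaryRep.{w} G)
    (e : Unitization ℂ (groupCStar.{w} G)) :
    π.onUnitization e
      = (e.fst • transl 1 + (e.snd : OperatorFamily.{w} G) : OperatorFamily.{w} G) π := by
  have h1 : transl (1 : G) π = (1 : π.H →L[ℂ] π.H) := by
    ext ξ
    simp [transl_apply]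
  have h2 : (e.fst • transl 1 + (e.snd : OperatorFamily.{w} G) : OperatorFamily.{w} G) π
      = e.fst • transl (1 : G) π + (e.snd : OperatorFamily.{w} G) π := rfl
  rw [h2, h1, ← π.onUnitization_inr, ← Algebra.algebraMap_eq_smul_one, ← AlgHomClass.commutes
    π.onUnitization, ← map_add, Unitization.algebraMap_eq_inl, Unitization.inl_fst_add_inr_snd_eq]

/-- Invariance under `C⋆(G)` implies invariance under `G`: `π.op g` takes `π.integrated f ξ` to
`π.integrated (leftTranslate g f) ξ`, and `ξ` is a limit of vectors `π.integrated f ξ`. -/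
theorem UnitaryRep.IsIrreducible.isIrreducibleSet_onUnitization {π : UnitaryRep.{w} G}
    (h : π.IsIrreducible) : IsIrreducibleSet (Set.range π.onUnitization) := by
  intro K hK hinv
  refine h.2 K hK fun g ξ hξ => ?_
  have hcl : ξ ∈ closure (Set.range fun f : C_c(G, ℂ) => π.integrated f ξ) := by
    rw [Metric.mem_closure_range_iff]
    intro ε hε
    obtain ⟨f, hf⟩ := π.exists_norm_integrated_sub_lt ξ hε
    exact ⟨f, by rwa [dist_comm, dist_eq_norm]⟩
  refine closure_minimal (t := {η | π.op g η ∈ K}) ?_ (hK.preimage (π.op g).continuous) hcl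
  rintro _ ⟨f, rfl⟩
  have h1 := hinv _ ⟨_, π.onUnitization_inr ⟨_, universalRep_mem_groupCStar (leftTranslate g f)⟩⟩
    ξ hξ
  have h2 := congrArg (fun x : OperatorFamily.{w} G => x π ξ) (transl_mul_universalRep g f)
  exact (congrArg (· ∈ K) h2).mpr h1

/-- Every vector state of an irreducible representation is approximated, on finite subsets of
`C⋆(G)`, by vector states of all representations in a neighbourhood. -/
theorem UnitaryDual.exists_isOpen_vectorState_close {π : UnitaryRep.{w} G} (hπ : π.IsIrreducible)
    {ξ : π.H} (hξ : ‖ξ‖ = 1) (F : Set (OperatorFamily.{w} G)) (hfin : F.Finite)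
    (hF : ∀ a ∈ F, a ∈ groupCStar.{w} G) {ε : ℝ} (hε : 0 < ε) :
    ∃ U : Set (UnitaryDual.{w} G), IsOpen U ∧ UnitaryDual.mk π hπ ∈ U ∧
      ∀ (σ : UnitaryRep.{w} G) (hσ : σ.IsIrreducible), UnitaryDual.mk σ hσ ∈ U →
        ∃ η : σ.H, ‖η‖ = 1 ∧ ∀ a ∈ F, ‖inner ℂ η (a σ η) - inner ℂ ξ (a π ξ)‖ < ε := by
  classical
  have hfin' : ((fun x : groupCStar.{w} G => (x : OperatorFamily.{w} G)) ⁻¹' F).Finite :=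
    hfin.preimage Subtype.val_injective.injOn
  obtain ⟨e, he, hclose⟩ := exists_forall_vectorState_close hπ.isIrreducibleSet_onUnitization hξ
    (hfin'.toFinset.image fun x : groupCStar.{w} G => (Unitization.inr x : Unitization ℂ _)) hε
  obtain ⟨U, hU, hmem⟩ := UnitaryDual.exists_isOpen_of_multiplier
    (T := (e.fst • transl 1 + (e.snd : OperatorFamily.{w} G) : OperatorFamily.{w} G)) fun f => by
      rw [add_mul, smul_mul_assoc, transl_one_mul]
      exact (groupCStar.{w} G).add_mem ((groupCStar.{w} G).smul_mem _
        (universalRep_mem_groupCStar f)) (mul_universalRep_mem_groupCStar e.snd.2 f)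
  refine ⟨U, hU, (hmem π hπ).2 (by rwa [← π.onUnitization_apply]), fun σ hσ hσU => ?_⟩
  have hσe := (hmem σ hσ).1 hσU
  rw [← σ.onUnitization_apply] at hσe
  obtain ⟨η, hη, hηF⟩ := hclose σ.H σ.onUnitization hσe
  refine ⟨η, hη, fun a ha => ?_⟩
  have h := hηF (Unitization.inr (⟨a, hF a ha⟩ : groupCStar.{w} G))
    (Finset.mem_image.2 ⟨⟨a, hF a ha⟩, hfin'.mem_toFinset.2 ha, rfl⟩)
  rwa [σ.onUnitization_inr, π.onUnitization_inr] at h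

end VectorStates

/-! ### Tensor products and the Fell topology -/

section TensorTopology

theorem UnitaryRep.inner_star_mul {G : Type u} [Group G] [TopologicalSpace G] (π : UnitaryRep.{w} G)
    (x y : OperatorFamily.{w} G) (ξ : π.H) :
    inner ℂ ξ ((star x * y) π ξ) = inner ℂ (x π ξ) (y π ξ) :=
  ContinuousLinearMap.adjoint_inner_right (x π) ξ (y π ξ)

theorem OperatorFamily.norm_apply_apply_le {G : Type u} [Group G] [TopologicalSpace G]
    (x : OperatorFamily.{w} G) (π : UnitaryRep.{w} G) (ξ : π.H) : ‖x π ξ‖ ≤ ‖x‖ * ‖ξ‖ :=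
  (x π).le_of_opNorm_le (lp.norm_apply_le_norm ENNReal.top_ne_zero x π) ξ

theorem OperatorFamily.sum_smul_apply {G : Type u} [Group G] [TopologicalSpace G] {ι : Type*}
    (s : Finset ι) (c : ι → ℂ) (x : ι → OperatorFamily.{w} G) (π : UnitaryRep.{w} G) (ξ : π.H) :
    (∑ j ∈ s, c j • x j) π ξ = ∑ j ∈ s, c j • x j π ξ := by
  classical
  induction s using Finset.induction_on with
  | empty => rfl
  | insert i s hi ih =>
    rw [Finset.sum_insert hi, Finset.sum_insert hi, ← ih]
    rfl

variable {G₁ : Type u} [Group G₁] [TopologicalSpace G₁]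
variable {G₂ : Type v} [Group G₂] [TopologicalSpace G₂]

/-- The norm of the sum is thereby a function of finitely many vector-state values in each factor
separately. -/
theorem UnitaryRep.inner_sum_tmul {ι : Type*} [Fintype ι] (π₁ : UnitaryRep.{w} G₁)
    (π₂ : UnitaryRep.{w} G₂) (c : ι → ℂ) (a : ι → OperatorFamily.{w} G₁)
    (b : ι → OperatorFamily.{w} G₂) (ξ : π₁.H) (η : π₂.H) :
    inner ℂ (∑ j, c j • tmul π₁ π₂ (a j π₁ ξ) (b j π₂ η))
        (∑ j, c j • tmul π₁ π₂ (a j π₁ ξ) (b j π₂ η))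
      = ∑ i, ∑ j, (starRingEnd ℂ (c i) * c j) *
          (inner ℂ ξ ((star (a i) * a j) π₁ ξ) * inner ℂ η ((star (b i) * b j) π₂ η)) := by
  rw [sum_inner]
  refine Finset.sum_congr rfl fun i _ => ?_
  rw [inner_sum]
  refine Finset.sum_congr rfl fun j _ => ?_
  rw [inner_smul_left, inner_smul_right, inner_tmul, inner_star_mul, inner_star_mul]
  ring

variable [IsTopologicalGroup G₁] [LocallyCompactSpace G₁]

/-- The operator of `(1, g.2)` commutes with those of `G₁`, hence with the action of `x₁`, and can
be moved past it to the second factor. -/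
theorem transl_mul_pullback_mul_pullback {x₁ : OperatorFamily.{w} G₁}
    (hx₁ : x₁ ∈ groupCStar.{w} G₁) (x₂ : OperatorFamily.{w} G₂) (g : G₁ × G₂) :
    transl g * (pullback (ContinuousMonoidHom.inl G₁ G₂) x₁ *
        pullback (ContinuousMonoidHom.inr G₁ G₂) x₂)
      = pullback (ContinuousMonoidHom.inl G₁ G₂) (transl g.1 * x₁) *
        pullback (ContinuousMonoidHom.inr G₁ G₂) (transl g.2 * x₂) := by
  refine OperatorFamily.ext fun ρ ξ => ?_
  let T : ρ.H →L[ℂ] ρ.H := ((ρ.op (1, g.2)).toContinuousLinearEquiv : ρ.H →L[ℂ] ρ.H)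
  have hcomm (r : G₁) : ρ.op (1, g.2) * ρ.op (r, 1) = ρ.op (r, 1) * ρ.op (1, g.2) := by
    rw [← map_mul, ← map_mul]
    simp
  have h := UnitaryRep.groupCStar_intertwine (π := ρ.comap (ContinuousMonoidHom.inl G₁ G₂))
    (σ := ρ.comap (ContinuousMonoidHom.inl G₁ G₂)) (T := T)
    (fun r ζ => congrArg (fun S : ρ.H ≃ₗᵢ[ℂ] ρ.H => S ζ) (hcomm r)) hx₁
  have h' (ζ : ρ.H) : ρ.op (1, g.2) (pullback (ContinuousMonoidHom.inl G₁ G₂) x₁ ρ ζ)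
      = pullback (ContinuousMonoidHom.inl G₁ G₂) x₁ ρ (ρ.op (1, g.2) ζ) :=
    congrArg (fun S : ρ.H →L[ℂ] ρ.H => S ζ) h
  have hg : ρ.op g = ρ.op (g.1, 1) * ρ.op (1, g.2) := by
    rw [← map_mul]
    simp
  have h2 (ζ : ρ.H) : ρ.op g ζ = ρ.op (g.1, 1) (ρ.op (1, g.2) ζ) :=
    congrArg (fun S : ρ.H ≃ₗᵢ[ℂ] ρ.H => S ζ) hg
  exact (h2 _).trans (congrArg (ρ.op (g.1, 1)) (h' _))

variable [IsTopologicalGroup G₂] [LocallyCompactSpace G₂]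

/-- A form of lower semicontinuity: the squared norm is the continuous function `Φ` of the
vector-state values, and `UnitaryDual.exists_isOpen_vectorState_close` reproduces these up to `ε` on
neighbourhoods in each factor. -/
theorem UnitaryDual.exists_isOpen_lt_norm_sum_tmul {ι : Type*} [Fintype ι]
    {π₁ : UnitaryRep.{w} G₁} {π₂ : UnitaryRep.{w} G₂} (h₁ : π₁.IsIrreducible)
    (h₂ : π₂.IsIrreducible) (c : ι → ℂ) {a : ι → OperatorFamily.{w} G₁}
    {b : ι → OperatorFamily.{w} G₂} (ha : ∀ j, a j ∈ groupCStar.{w} G₁)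
    (hb : ∀ j, b j ∈ groupCStar.{w} G₂) {ξ : π₁.H} {η : π₂.H} (hξ : ‖ξ‖ = 1) (hη : ‖η‖ = 1)
    {δ : ℝ} (hδ : 0 ≤ δ)
    (h : δ < ‖∑ j, c j • UnitaryRep.tmul π₁ π₂ (a j π₁ ξ) (b j π₂ η)‖) :
    ∃ U₁ : Set (UnitaryDual.{w} G₁), IsOpen U₁ ∧ UnitaryDual.mk π₁ h₁ ∈ U₁ ∧
    ∃ U₂ : Set (UnitaryDual.{w} G₂), IsOpen U₂ ∧ UnitaryDual.mk π₂ h₂ ∈ U₂ ∧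
      ∀ (σ₁ : UnitaryRep.{w} G₁) (hσ₁ : σ₁.IsIrreducible) (σ₂ : UnitaryRep.{w} G₂)
        (hσ₂ : σ₂.IsIrreducible), UnitaryDual.mk σ₁ hσ₁ ∈ U₁ → UnitaryDual.mk σ₂ hσ₂ ∈ U₂ →
        ∃ (ξ' : σ₁.H) (η' : σ₂.H), ‖ξ'‖ = 1 ∧ ‖η'‖ = 1 ∧
          δ < ‖∑ j, c j • UnitaryRep.tmul σ₁ σ₂ (a j σ₁ ξ') (b j σ₂ η')‖ := by
  let Φ : (ι × ι → ℂ) × (ι × ι → ℂ) → ℝ := fun p =>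
    Complex.re (∑ i, ∑ j, (starRingEnd ℂ (c i) * c j) * (p.1 (i, j) * p.2 (i, j)))
  have hΦ : Continuous Φ := by fun_prop
  let v₁ (σ : UnitaryRep.{w} G₁) (ζ : σ.H) : ι × ι → ℂ :=
    fun p => inner ℂ ζ ((star (a p.1) * a p.2) σ ζ)
  let v₂ (σ : UnitaryRep.{w} G₂) (ζ : σ.H) : ι × ι → ℂ :=
    fun p => inner ℂ ζ ((star (b p.1) * b p.2) σ ζ)
  have hsq (σ₁ : UnitaryRep.{w} G₁) (σ₂ : UnitaryRep.{w} G₂) (ξ' : σ₁.H) (η' : σ₂.H) :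
      Φ (v₁ σ₁ ξ', v₂ σ₂ η')
        = ‖∑ j, c j • UnitaryRep.tmul σ₁ σ₂ (a j σ₁ ξ') (b j σ₂ η')‖ ^ 2 := by
    rw [← inner_self_eq_norm_sq (𝕜 := ℂ), UnitaryRep.inner_sum_tmul]
    rfl
  have hlt : δ ^ 2 < Φ (v₁ π₁ ξ, v₂ π₂ η) := by
    rw [hsq]
    exact pow_lt_pow_left₀ h hδ two_ne_zero
  obtain ⟨ε, hε, hball⟩ := Metric.mem_nhds_iff.1
    (hΦ.continuousAt.eventually_const_lt hlt : {p | δ ^ 2 < Φ p} ∈ _)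
  obtain ⟨U₁, hU₁, hm₁, hcl₁⟩ := UnitaryDual.exists_isOpen_vectorState_close h₁ hξ
    (Set.range fun p : ι × ι => star (a p.1) * a p.2) (Set.finite_range _)
    (by
      rintro _ ⟨p, rfl⟩
      exact (groupCStar.{w} G₁).mul_mem ((groupCStar.{w} G₁).star_mem' (ha p.1)) (ha p.2)) hε
  obtain ⟨U₂, hU₂, hm₂, hcl₂⟩ := UnitaryDual.exists_isOpen_vectorState_close h₂ hη
    (Set.range fun p : ι × ι => star (b p.1) * b p.2) (Set.finite_range _)
    (by
      rintro _ ⟨p, rfl⟩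
      exact (groupCStar.{w} G₂).mul_mem ((groupCStar.{w} G₂).star_mem' (hb p.1)) (hb p.2)) hε
  refine ⟨U₁, hU₁, hm₁, U₂, hU₂, hm₂, fun σ₁ hσ₁ σ₂ hσ₂ hin₁ hin₂ => ?_⟩
  obtain ⟨ξ', hξ', hc₁⟩ := hcl₁ σ₁ hσ₁ hin₁
  obtain ⟨η', hη', hc₂⟩ := hcl₂ σ₂ hσ₂ hin₂
  refine ⟨ξ', η', hξ', hη', ?_⟩
  have hmem : (v₁ σ₁ ξ', v₂ σ₂ η') ∈ Metric.ball (v₁ π₁ ξ, v₂ π₂ η) ε := by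
    rw [Metric.mem_ball, Prod.dist_eq, max_lt_iff, dist_pi_lt_iff hε, dist_pi_lt_iff hε]
    exact ⟨fun p => (dist_eq_norm _ _).trans_lt (hc₁ _ ⟨p, rfl⟩),
      fun p => (dist_eq_norm _ _).trans_lt (hc₂ _ ⟨p, rfl⟩)⟩
  have h2 : δ ^ 2 < Φ (v₁ σ₁ ξ', v₂ σ₂ η') := hball hmem
  rw [hsq] at h2
  exact lt_of_pow_lt_pow_left₀ 2 (norm_nonneg _) h2

theorem continuous_transl_mul_pullback_mul_pullback (f₁ : C_c(G₁, ℂ)) (f₂ : C_c(G₂, ℂ)) :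
    Continuous fun g : G₁ × G₂ => (transl g *
      (pullback (ContinuousMonoidHom.inl G₁ G₂) (universalRep f₁) *
        pullback (ContinuousMonoidHom.inr G₁ G₂) (universalRep f₂)) :
      OperatorFamily.{w} (G₁ × G₂)) := by
  simp_rw [transl_mul_pullback_mul_pullback (universalRep_mem_groupCStar f₁)]
  exact ((continuous_pullback _).comp
    ((continuous_transl_mul_universalRep f₁).comp continuous_fst)).mul
    ((continuous_pullback _).comp ((continuous_transl_mul_universalRep f₂).comp continuous_snd))

theorem UnitaryRep.pullback_mul_pullback_tmul (π₁ : UnitaryRep.{w} G₁) (π₂ : UnitaryRep.{w} G₂)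
    {x₁ : OperatorFamily.{w} G₁} (hx₁ : x₁ ∈ groupCStar.{w} G₁) {x₂ : OperatorFamily.{w} G₂}
    (hx₂ : x₂ ∈ groupCStar.{w} G₂) (ξ : π₁.H) (η : π₂.H) :
    (pullback (ContinuousMonoidHom.inl G₁ G₂) x₁ * pullback (ContinuousMonoidHom.inr G₁ G₂) x₂)
        (π₁.tensor π₂) (tmul π₁ π₂ ξ η) = tmul π₁ π₂ (x₁ π₁ ξ) (x₂ π₂ η) := by
  rw [OperatorFamily.mul_apply, pullback_inr_tmul π₁ π₂ hx₂, pullback_inl_tmul π₁ π₂ hx₁]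

theorem UnitaryRep.exists_norm_eq_one_integrated_ne_zero {G : Type u} [Group G]
    [TopologicalSpace G] [IsTopologicalGroup G] [LocallyCompactSpace G] {π : UnitaryRep.{w} G}
    {L : Type*} [NormedAddCommGroup L] [NormedSpace ℂ L] {S : π.H →L[ℂ] L} (hS : S ≠ 0) :
    ∃ (f : C_c(G, ℂ)) (ξ : π.H), ‖ξ‖ = 1 ∧ S (π.integrated f ξ) ≠ 0 := by
  obtain ⟨f, hf⟩ : ∃ f : C_c(G, ℂ), S ∘L π.integrated f ≠ 0 := by
    by_contra! h
    refine hS (ContinuousLinearMap.ext fun ξ => ?_)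
    have hcl : ξ ∈ closure (Set.range fun f : C_c(G, ℂ) => π.integrated f ξ) := by
      rw [Metric.mem_closure_range_iff]
      intro ε hε
      obtain ⟨f, hf⟩ := π.exists_norm_integrated_sub_lt ξ hε
      exact ⟨f, by rwa [dist_comm, dist_eq_norm]⟩
    refine closure_minimal (t := {η | S η = 0}) ?_
      (isClosed_eq S.continuous continuous_const) hcl
    rintro _ ⟨f, rfl⟩
    exact congrArg (fun R : π.H →L[ℂ] L => R ξ) (h f)
  obtain ⟨ξ, hξ⟩ := DFunLike.ne_iff.1 hf
  have hξ0 : ‖ξ‖ ≠ 0 := fun h0 => hξ (by rw [norm_eq_zero.1 h0, map_zero, map_zero])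
  refine ⟨f, ((‖ξ‖⁻¹ : ℝ) : ℂ) • ξ, ?_, ?_⟩
  · rw [norm_smul, Complex.norm_real, norm_inv, norm_norm, inv_mul_cancel₀ hξ0]
  · rw [map_smul, map_smul]
    exact smul_ne_zero (Complex.ofReal_ne_zero.2 (inv_ne_zero hξ0)) hξ

/-- Non-vanishing of an element of `C⋆(G₁ × G₂)` on tensor products is an open condition. -/
theorem UnitaryDual.exists_isOpen_tensor_ne_zero {π₁ : UnitaryRep.{w} G₁} {π₂ : UnitaryRep.{w} G₂}
    (h₁ : π₁.IsIrreducible) (h₂ : π₂.IsIrreducible) {x : OperatorFamily.{w} (G₁ × G₂)}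
    (hx : x ∈ groupCStar.{w} (G₁ × G₂)) (hne : x (π₁.tensor π₂) ≠ 0) :
    ∃ U₁ : Set (UnitaryDual.{w} G₁), IsOpen U₁ ∧ UnitaryDual.mk π₁ h₁ ∈ U₁ ∧
    ∃ U₂ : Set (UnitaryDual.{w} G₂), IsOpen U₂ ∧ UnitaryDual.mk π₂ h₂ ∈ U₂ ∧
      ∀ (σ₁ : UnitaryRep.{w} G₁) (hσ₁ : σ₁.IsIrreducible) (σ₂ : UnitaryRep.{w} G₂)
        (hσ₂ : σ₂.IsIrreducible), UnitaryDual.mk σ₁ hσ₁ ∈ U₁ → UnitaryDual.mk σ₂ hσ₂ ∈ U₂ →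
        x (σ₁.tensor σ₂) ≠ 0 := by
  obtain ⟨ξ₀, η₀, hξη₀⟩ : ∃ (ξ₀ : π₁.H) (η₀ : π₂.H),
      x (π₁.tensor π₂) (UnitaryRep.tmul π₁ π₂ ξ₀ η₀) ≠ 0 := by
    by_contra! h
    exact hne (UnitaryRep.tmul_hom_ext fun ξ η => h ξ η)
  -- Smoothing one variable at a time gives unit vectors with `x (f₁ ξ ⊗ f₂ η) ≠ 0`, that is, `x *
  -- y` does not kill `ξ ⊗ η`.
  obtain ⟨f₁, ξ, hξ, hf₁⟩ := UnitaryRep.exists_norm_eq_one_integrated_ne_zero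
    (S := x (π₁.tensor π₂) ∘L UnitaryRep.tmulRight π₁ π₂ η₀) (DFunLike.ne_iff.2 ⟨ξ₀, hξη₀⟩)
  obtain ⟨f₂, η, hη, hf₂⟩ := UnitaryRep.exists_norm_eq_one_integrated_ne_zero
    (S := x (π₁.tensor π₂) ∘L UnitaryRep.tmulLeft π₁ π₂ (π₁.integrated f₁ ξ))
    (DFunLike.ne_iff.2 ⟨η₀, hf₁⟩)
  let y : OperatorFamily.{w} (G₁ × G₂) :=
    pullback (ContinuousMonoidHom.inl G₁ G₂) (universalRep f₁) *
      pullback (ContinuousMonoidHom.inr G₁ G₂) (universalRep f₂)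
  have hw : x * y ∈ translSpan y := mul_mem_translSpan_of_mem_groupCStar
    (continuous_transl_mul_pullback_mul_pullback f₁ f₂) hx (self_mem_translSpan y)
  have hpos : 0 < ‖(x * y) (π₁.tensor π₂) (UnitaryRep.tmul π₁ π₂ ξ η)‖ := by
    rw [norm_pos_iff, OperatorFamily.mul_apply, UnitaryRep.pullback_mul_pullback_tmul π₁ π₂
      (universalRep_mem_groupCStar f₁) (universalRep_mem_groupCStar f₂)]
    exact hf₂
  -- Half the norm: an approximation to within `δ` still exceeds `δ` at `π₁ ⊗ π₂`, and wherever it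
  -- exceeds `δ` at a tensor of unit vectors, `x * y` cannot vanish there.
  let δ : ℝ := ‖(x * y) (π₁.tensor π₂) (UnitaryRep.tmul π₁ π₂ ξ η)‖ / 2
  have hδ : 0 < δ := half_pos hpos
  obtain ⟨z, hz, hdist⟩ := Metric.mem_closure_iff.1 hw δ hδ
  obtain ⟨n, c, t, rfl⟩ := Submodule.mem_span_set'.1 hz
  choose g hg using fun j => (t j).2
  let a : Fin n → OperatorFamily.{w} G₁ := fun j => transl (g j).1 * universalRep f₁
  let b : Fin n → OperatorFamily.{w} G₂ := fun j => transl (g j).2 * universalRep f₂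
  have ha (j : Fin n) : a j ∈ groupCStar.{w} G₁ := by
    change transl (g j).1 * universalRep f₁ ∈ _
    rw [transl_mul_universalRep]
    exact universalRep_mem_groupCStar _
  have hb (j : Fin n) : b j ∈ groupCStar.{w} G₂ := by
    change transl (g j).2 * universalRep f₂ ∈ _
    rw [transl_mul_universalRep]
    exact universalRep_mem_groupCStar _
  have hval (σ₁ : UnitaryRep.{w} G₁) (σ₂ : UnitaryRep.{w} G₂) (ξ' : σ₁.H) (η' : σ₂.H) :
      (∑ j, c j • (t j : OperatorFamily.{w} (G₁ × G₂))) (σ₁.tensor σ₂)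
          (UnitaryRep.tmul σ₁ σ₂ ξ' η')
        = ∑ j, c j • UnitaryRep.tmul σ₁ σ₂ (a j σ₁ ξ') (b j σ₂ η') := by
    rw [OperatorFamily.sum_smul_apply]
    refine Finset.sum_congr rfl fun j _ => ?_
    have h3 : (t j : OperatorFamily.{w} (G₁ × G₂))
        = pullback (ContinuousMonoidHom.inl G₁ G₂) (a j)
          * pullback (ContinuousMonoidHom.inr G₁ G₂) (b j) :=
      (hg j).symm.trans (transl_mul_pullback_mul_pullback (universalRep_mem_groupCStar f₁) _ _)
    rw [h3, UnitaryRep.pullback_mul_pullback_tmul σ₁ σ₂ (ha j) (hb j)]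
  have hclose (σ₁ : UnitaryRep.{w} G₁) (σ₂ : UnitaryRep.{w} G₂) {ξ' : σ₁.H} {η' : σ₂.H}
      (hξ' : ‖ξ'‖ = 1) (hη' : ‖η'‖ = 1) :
      ‖(x * y) (σ₁.tensor σ₂) (UnitaryRep.tmul σ₁ σ₂ ξ' η')
        - ∑ j, c j • UnitaryRep.tmul σ₁ σ₂ (a j σ₁ ξ') (b j σ₂ η')‖ < δ := by
    rw [← hval]
    refine lt_of_le_of_lt ?_ ((dist_eq_norm _ _).symm.trans_lt hdist)
    have h3 := OperatorFamily.norm_apply_apply_le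
      (x * y - ∑ j, c j • (t j : OperatorFamily.{w} (G₁ × G₂))) (σ₁.tensor σ₂)
      (UnitaryRep.tmul σ₁ σ₂ ξ' η')
    rwa [UnitaryRep.norm_tmul, hξ', hη', mul_one, mul_one] at h3
  obtain ⟨U₁, hU₁, hm₁, U₂, hU₂, hm₂, hU⟩ :=
    UnitaryDual.exists_isOpen_lt_norm_sum_tmul h₁ h₂ c ha hb hξ hη hδ.le (by
      have := norm_sub_norm_le ((x * y) (π₁.tensor π₂) (UnitaryRep.tmul π₁ π₂ ξ η))
        (∑ j, c j • UnitaryRep.tmul π₁ π₂ (a j π₁ ξ) (b j π₂ η))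
      have h3 := hclose π₁ π₂ hξ hη
      have h4 : ‖(x * y) (π₁.tensor π₂) (UnitaryRep.tmul π₁ π₂ ξ η)‖ = δ + δ :=
        (add_halves _).symm
      linarith)
  refine ⟨U₁, hU₁, hm₁, U₂, hU₂, hm₂, fun σ₁ hσ₁ σ₂ hσ₂ hin₁ hin₂ h0 => ?_⟩
  obtain ⟨ξ', η', hξ', hη', hlt⟩ := hU σ₁ hσ₁ σ₂ hσ₂ hin₁ hin₂
  have h3 := hclose σ₁ σ₂ hξ' hη'
  have h4 : (x * y) (σ₁.tensor σ₂) (UnitaryRep.tmul σ₁ σ₂ ξ' η') = 0 := by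
    rw [OperatorFamily.mul_apply, h0]
    rfl
  rw [h4, zero_sub, norm_neg] at h3
  exact lt_asymm hlt h3

end TensorTopology

/-! ### The map `J` -/

section DualTensor

variable {G₁ : Type u} [Group G₁] [TopologicalSpace G₁]
variable {G₂ : Type v} [Group G₂] [TopologicalSpace G₂]

/-- The map `([π₁], [π₂]) ↦ [π₁ ⊗ π₂]` between unitary duals. -/
def UnitaryDual.tensor (p : UnitaryDual.{w} G₁ × UnitaryDual.{w} G₂) :
    UnitaryDual.{w} (G₁ × G₂) :=
  Quotient.map₂ (fun π₁ π₂ => ⟨π₁.1.tensor π₂.1, π₁.2.tensor π₂.2⟩)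
    (fun _ _ h₁ _ _ h₂ => UnitaryRep.Equivalent.tensor h₁ h₂) p.1 p.2

theorem UnitaryDual.tensor_mk {π₁ : UnitaryRep.{w} G₁} {π₂ : UnitaryRep.{w} G₂}
    (h₁ : π₁.IsIrreducible) (h₂ : π₂.IsIrreducible) :
    UnitaryDual.tensor (UnitaryDual.mk π₁ h₁, UnitaryDual.mk π₂ h₂)
      = UnitaryDual.mk (π₁.tensor π₂) (h₁.tensor h₂) := rfl

theorem UnitaryDual.exists_eq_mk {G : Type u} [Group G] [TopologicalSpace G]
    (z : UnitaryDual.{w} G) : ∃ (π : UnitaryRep.{w} G) (h : π.IsIrreducible), z = .mk π h :=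
  Quotient.inductionOn z fun π => ⟨π.1, π.2, rfl⟩

variable [IsTopologicalGroup G₁] [LocallyCompactSpace G₁]
variable [IsTopologicalGroup G₂] [LocallyCompactSpace G₂]

theorem UnitaryDual.continuous_tensor :
    Continuous (UnitaryDual.tensor.{w} (G₁ := G₁) (G₂ := G₂)) := by
  refine continuous_generateFrom_iff.2 ?_
  rintro _ ⟨x, rfl⟩
  refine isOpen_prod_iff.2 fun z₁ z₂ hz => ?_
  obtain ⟨π₁, h₁, rfl⟩ := z₁.exists_eq_mk
  obtain ⟨π₂, h₂, rfl⟩ := z₂.exists_eq_mk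
  obtain ⟨U₁, hU₁, hm₁, U₂, hU₂, hm₂, hU⟩ :=
    UnitaryDual.exists_isOpen_tensor_ne_zero h₁ h₂ x.2 hz
  refine ⟨U₁, U₂, hU₁, hU₂, hm₁, hm₂, ?_⟩
  rintro ⟨z₁, z₂⟩ ⟨hz₁, hz₂⟩
  obtain ⟨σ₁, hσ₁, rfl⟩ := z₁.exists_eq_mk
  obtain ⟨σ₂, hσ₂, rfl⟩ := z₂.exists_eq_mk
  exact hU σ₁ hσ₁ σ₂ hσ₂ hz₁ hz₂

/-- `pullback φ x` is a left multiplier: its product with `universalRep f` stays in the closed span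
of the translates of `universalRep f`, which lies in `C⋆(G)`. -/
theorem UnitaryDual.exists_isOpen_of_pullback {S : Type u} [Group S] [TopologicalSpace S]
    [IsTopologicalGroup S] [LocallyCompactSpace S] {G : Type v} [Group G] [TopologicalSpace G]
    [IsTopologicalGroup G] [LocallyCompactSpace G] (φ : S →ₜ* G) {x : OperatorFamily.{w} S}
    (hx : x ∈ groupCStar.{w} S) : ∃ V : Set (UnitaryDual.{w} G), IsOpen V ∧
      ∀ (π : UnitaryRep.{w} G) (hπ : π.IsIrreducible),
        UnitaryDual.mk π hπ ∈ V ↔ pullback φ x π ≠ 0 :=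
  UnitaryDual.exists_isOpen_of_multiplier fun f => translSpan_universalRep_le f
    (pullback_mul_mem_translSpan φ (continuous_transl_mul_universalRep f) hx
      (self_mem_translSpan _))

/-- The product topology is the infimum of the topologies induced by the two projections, so beyond
continuity it suffices that both projections are continuous for the topology induced by the tensor
map. -/
theorem UnitaryDual.isInducing_tensor :
    IsInducing (UnitaryDual.tensor.{w} (G₁ := G₁) (G₂ := G₂)) := by
  refine ⟨le_antisymm UnitaryDual.continuous_tensor.le_induced ?_⟩
  refine le_inf (continuous_iff_le_induced.1 ?_) (continuous_iff_le_induced.1 ?_)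
  · refine continuous_generateFrom_iff.2 ?_
    rintro _ ⟨x, rfl⟩
    obtain ⟨V, hV, hmem⟩ :=
      UnitaryDual.exists_isOpen_of_pullback (ContinuousMonoidHom.inl G₁ G₂) x.2
    refine isOpen_induced_iff.2 ⟨V, hV, ?_⟩
    ext ⟨z₁, z₂⟩
    obtain ⟨π₁, h₁, rfl⟩ := z₁.exists_eq_mk
    obtain ⟨π₂, h₂, rfl⟩ := z₂.exists_eq_mk
    have := h₂.1
    exact (hmem _ (h₁.tensor h₂)).trans
      (UnitaryRep.pullback_inl_tensor_eq_zero_iff π₁ π₂ x.2).not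
  · refine continuous_generateFrom_iff.2 ?_
    rintro _ ⟨x, rfl⟩
    obtain ⟨V, hV, hmem⟩ :=
      UnitaryDual.exists_isOpen_of_pullback (ContinuousMonoidHom.inr G₁ G₂) x.2
    refine isOpen_induced_iff.2 ⟨V, hV, ?_⟩
    ext ⟨z₁, z₂⟩
    obtain ⟨π₁, h₁, rfl⟩ := z₁.exists_eq_mk
    obtain ⟨π₂, h₂, rfl⟩ := z₂.exists_eq_mk
    have := h₁.1
    exact (hmem _ (h₁.tensor h₂)).trans
      (UnitaryRep.pullback_inr_tensor_eq_zero_iff π₁ π₂ x.2).not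

end DualTensor

end

/-- For locally compact groups `G₁` and `G₂`, the map `J([π₁], [π₂]) = [π₁ ⊗ π₂]` between unitary
duals with the Fell topologies is well defined, continuous, and relatively open (it maps open sets
onto relatively open subsets of its range). -/
theorem propositionA1 {G₁ : Type u} {G₂ : Type v}
    [Group G₁] [TopologicalSpace G₁] [IsTopologicalGroup G₁] [LocallyCompactSpace G₁] [T2Space G₁]
    [Group G₂] [TopologicalSpace G₂] [IsTopologicalGroup G₂] [LocallyCompactSpace G₂]
    [T2Space G₂] :
    ∃ J : UnitaryDual.{max u v} G₁ × UnitaryDual.{max u v} G₂ → UnitaryDual.{max u v} (G₁ × G₂),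
      (∀ (π₁ : UnitaryRep.{max u v} G₁) (π₂ : UnitaryRep.{max u v} G₂)
        (h₁ : π₁.IsIrreducible) (h₂ : π₂.IsIrreducible),
        ∃ h : (π₁.tensor π₂).IsIrreducible,
          J (UnitaryDual.mk π₁ h₁, UnitaryDual.mk π₂ h₂) = UnitaryDual.mk (π₁.tensor π₂) h) ∧
      Continuous J ∧
      ∀ W : Set (UnitaryDual.{max u v} G₁ × UnitaryDual.{max u v} G₂), IsOpen W →
        ∃ V : Set (UnitaryDual.{max u v} (G₁ × G₂)), IsOpen V ∧ J '' W = V ∩ Set.range J := by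
  refine ⟨UnitaryDual.tensor, fun π₁ π₂ h₁ h₂ => ⟨h₁.tensor h₂, UnitaryDual.tensor_mk h₁ h₂⟩,
    UnitaryDual.continuous_tensor, fun W hW => ?_⟩
  -- Every open `W` is a preimage `J ⁻¹' V`, so its image is `V ∩ range J` without appeal to
  -- injectivity.
  obtain ⟨V, hV, rfl⟩ := UnitaryDual.isInducing_tensor.isOpen_iff.1 hW
  exact ⟨V, hV, Set.image_preimage_eq_inter_range⟩
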